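/- **Setting.** A finite edge-emitting HMM $M=(\mathcal S,\mathcal X,\{T^{(x)}\})$ consists of a finite nonempty state set $\mathcal S$, a finite alphabet $\mathcal X$ and nonnegative matrices $T^{(x)}$ ($x\in\mathcal X$) whose sum $T$ is stochastic; from state $i$ it emits $x$ and moves to $j$ with probability $T^{(x)}_{ij}$. A finite state-emitting HMM $(\mathcal S,\mathcal X,T,O)$ has a stochastic transition matrix $T$ and a stochastic observation matrix $O$, with $O_{ix}=\mathbb P(X_t=x\mid S_t=i)$. Every symbol can be generated from some state. The HMM is irreducible if $T$ is. Then $\pi$ denotes the stationary distribution of $T$, $\mathbb P$ the stationary law of the state-symbol sequence $(S_t,X_t)$ with $S_0\sim\pi$, and $\mathbb P_i$ the law with $S_0=i$. Put $h=\lim_t H(X_1,\dots,X_t)/t$ and $h(t)=H(X_t\mid X_1,\dots,X_{t-1})$ for $t\ge 1$, computed under $\mathbb P$ with base-2 entropies. The period $\mathrm{per}(M)$ is the greatest common divisor of the lengths of the closed walks in the directed graph of $T$. For a word $w$, $\delta_i(w)$ is the set of states in which the HMM, started in $i$, can be after emitting $w$ with positive probability ($\delta_i$ of the empty word is $\{i\}$).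 $M$ is *path-mergeable* if for all states $i\ne j$ there is a word $w$ with $\delta_i(w)\cap\delta_j(w)\neq\emptyset$. A symbol $x$ is a *flag symbol* for a state $k$ if $k\in\delta_i(x)$ for every $i$ with $\delta_i(x)\ne\emptyset$; $M$ is *flag-state* if every state has a flag symbol. For an irreducible edge-emitting $M$ and $n\ge1$, the *block model* $M^n$ is the edge-emitting HMM on $\mathcal S$ whose symbols are the length-$n$ words $w$ with $\mathbb P(X_0^{n-1}=w)>0$ and whose transition matrices are $Q^{(w)}_{ij}=\mathbb P_i(X_0^{n-1}=w,\,S_n=j)$. For an edge-emitting HMM and a choice of flag symbols $y=(y_j)_{j\in\mathcal S}$, $y_j$ a flag symbol for $j$, let $p_*=\min_j\mathbb P(X_0=y_j\mid S_1=j)$, let $q_*=\min_j\min_i \mathbb P_i(S_1=j\mid X_0=y_j)$ with $i$ ranging over the states that can generate $y_j$, let $r_*=\min_{i,j}\pi_i/\pi_j$, $\eta=\frac{p_*r_*}{2|\mathcal S|}$, and $$\alpha(y)=\max\Big\{\exp\Big(-\frac{p_*^2r_*^2}{2|\mathcal S|^2}\Big),\ (1-q_*^2)^{\eta}\Big\}.$$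 **Theorem.** (A) Let $M$ be an irreducible finite edge-emitting HMM. The limit defining $h$ exists, $h\le h(t)$ for all $t\ge1$, and: 1. If $n\ge1$ is coprime to $\mathrm{per}(M)$ and $M^n$ is flag-state, then for every choice $y$ of flag symbols of $M^n$ the rate $\alpha=\alpha(y)$, computed for $M^n$, satisfies $0<\alpha<1$ and $$\limsup_{t\to\infty}\,(h(t)-h)^{1/t}\le\alpha^{1/n}.$$ 2. If $M$ is path-mergeable, then $M^n$ is flag-state for some $n\ge1$ coprime to $\mathrm{per}(M)$, and $\limsup_{t\to\infty}(h(t)-h)^{1/t}<1$. (B) Let $M$ be an irreducible finite state-emitting HMM, and let $M'$ be the (irreducible) edge-emitting HMM with $T'^{(x)}_{ij}=T_{ij}O_{jx}$. For the stationary output process of $M$, the limit defining $h$ exists, $h\le h(t)$ for all $t\ge1$, and: 1. If $n\ge1$ is coprime to $\mathrm{per}(M')$ and $(M')^n$ is flag-state, then for every choice $y$ of flag symbols of $(M')^n$ the rate $\alpha=\alpha(y)$, computed for $(M')^n$, satisfies $0<\alpha<1$ and $\limsup_{t\to\infty}(h(t)-h)^{1/t}\le\alpha^{1/n}$. 2.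 If $M$ is path-mergeable, then $\limsup_{t\to\infty}(h(t)-h)^{1/t}<1$. -/

import Mathlib

open Filter Topology

noncomputable section

/-! ### Entropy of finite distributions, entropy rate and finite-block estimates -/

/-- The entropy (in bits) of a distribution `p` on a finite set. -/
def entropy {A : Type*} [Fintype A] (p : A → ℝ) : ℝ :=
  -∑ a, p a * Real.logb 2 (p a)

/-- The conditional entropy `H(A | B)` of a pair of random variables with joint distribution
`p b a = ℙ(B = b, A = a)`, namely `∑ b, ℙ(b) * H(A | B = b)`. -/
def condEntropy {A B : Type*} [Fintype A] [Fintype B] (p : B → A → ℝ) : ℝ :=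
  ∑ b, (∑ a, p b a) * entropy (fun a => p b a / ∑ a', p b a')

section WordLaw

variable {X : Type*} [Fintype X]

/-- `H(X_1, …, X_t)` for a process with finite-dimensional laws `P t w = ℙ(X_1^t = w)`. -/
def blockEntropy (P : ∀ t : ℕ, (Fin t → X) → ℝ) (t : ℕ) : ℝ :=
  entropy (P t)

/-- The estimate `h(t) = H(X_t | X_1, …, X_{t-1})`, meaningful for `t ≥ 1`. -/
def blockEstimate (P : ∀ t : ℕ, (Fin t → X) → ℝ) : ℕ → ℝ
  | 0 => 0
  | m + 1 => condEntropy (fun (w : Fin m → X) (x : X) =>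
      P (m + 1) (Fin.snoc (α := fun _ => X) w x))

/-- The entropy rate `h = lim_{t → ∞} H(X_1, …, X_t) / t`. -/
def entropyRate (P : ∀ t : ℕ, (Fin t → X) → ℝ) : ℝ :=
  limUnder atTop (fun t : ℕ => blockEntropy P t / (t : ℝ))

/-- `limsup_{t → ∞} (h(t) - h)^{1/t}`, as an extended real number. -/
def convergenceRate (P : ∀ t : ℕ, (Fin t → X) → ℝ) : EReal :=
  limsup (fun t : ℕ =>
    (((blockEstimate P t - entropyRate P) ^ (1 / (t : ℝ)) : ℝ) : EReal)) atTop

end WordLaw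

/-! ### Stochastic matrices -/

section Stochastic

variable {S : Type*} [Fintype S]

/-- `p` is a probability vector with `p = p A`. -/
def IsStationaryDist (A : Matrix S S ℝ) (p : S → ℝ) : Prop :=
  (∀ i, 0 ≤ p i) ∧ ∑ i, p i = 1 ∧ Matrix.vecMul p A = p

theorem exists_isStationaryDist [DecidableEq S] [Nonempty S] {A : Matrix S S ℝ}
    (h0 : ∀ i j, 0 ≤ A i j) (h1 : ∀ i, ∑ j, A i j = 1) : ∃ p, IsStationaryDist A p := by
  have hdet : (1 - A).det = 0 := by
    apply Matrix.exists_mulVec_eq_zero_iff.1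
    refine ⟨fun _ => 1, ?_, ?_⟩
    · intro h
      have := congrFun h (Classical.arbitrary S)
      simp at this
    · ext i
      have h2 : Matrix.mulVec A (fun _ => 1) i = 1 := by simp [Matrix.mulVec, dotProduct, h1]
      rw [Matrix.sub_mulVec, Matrix.one_mulVec, Pi.sub_apply, h2, sub_self, Pi.zero_apply]
  obtain ⟨v, hv0, hv⟩ := Matrix.exists_vecMul_eq_zero_iff.2 hdet
  have hvA : ∀ j, ∑ i, v i * A i j = v j := by
    intro j
    have := congrFun hv j
    rw [Matrix.vecMul_sub] at this
    simp only [Matrix.vecMul_one, Pi.sub_apply, Pi.zero_apply, Matrix.vecMul, dotProduct] at this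
    linarith
  have hle : ∀ j ∈ Finset.univ, |v j| ≤ ∑ i, |v i| * A i j := by
    intro j _
    calc |v j| = |∑ i, v i * A i j| := by rw [hvA]
      _ ≤ ∑ i, |v i * A i j| := Finset.abs_sum_le_sum_abs _ _
      _ = ∑ i, |v i| * A i j := by
        refine Finset.sum_congr rfl fun i _ => ?_
        rw [abs_mul, abs_of_nonneg (h0 i j)]
  have hsum : ∑ j, |v j| = ∑ j, ∑ i, |v i| * A i j := by
    rw [Finset.sum_comm]
    refine Finset.sum_congr rfl fun i _ => ?_
    rw [← Finset.mul_sum, h1, mul_one]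
  have heq := (Finset.sum_eq_sum_iff_of_le hle).1 hsum
  have hpos : 0 < ∑ j, |v j| := by
    obtain ⟨j, hj⟩ := Function.ne_iff.1 hv0
    exact Finset.sum_pos' (fun i _ => abs_nonneg _) ⟨j, Finset.mem_univ _, abs_pos.2 hj⟩
  refine ⟨fun i => |v i| / ∑ j, |v j|, fun i => by positivity, ?_, ?_⟩
  · rw [← Finset.sum_div, div_self hpos.ne']
  · ext j
    simp only [Matrix.vecMul, dotProduct]
    rw [heq j (Finset.mem_univ _), Finset.sum_div]
    refine Finset.sum_congr rfl fun i _ => ?_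
    ring

theorem IsStationaryDist.pos [DecidableEq S] {A : Matrix S S ℝ} {p : S → ℝ}
    (hp : IsStationaryDist A p) (hA : A.IsIrreducible) (j : S) : 0 < p j := by
  obtain ⟨hp0, hp1, hpA⟩ := hp
  have hi : ∃ i, 0 < p i := by
    by_contra! hcon
    have : ∑ i, p i ≤ 0 := Finset.sum_nonpos fun i _ => hcon i
    linarith
  obtain ⟨i, hi⟩ := hi
  obtain ⟨k, -, hk⟩ := (Matrix.isIrreducible_iff_exists_pow_pos hA.nonneg).1 hA i j
  have hpk : Matrix.vecMul p (A ^ k) = p := by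
    clear hk
    induction k with
    | zero => simp
    | succ k ih => rw [pow_succ, ← Matrix.vecMul_vecMul, ih, hpA]
  have hj := congrFun hpk j
  simp only [Matrix.vecMul, dotProduct] at hj
  rw [← hj]
  exact Finset.sum_pos' (fun l _ => mul_nonneg (hp0 l) (Matrix.pow_apply_nonneg hA.nonneg k l j))
    ⟨i, Finset.mem_univ _, mul_pos hi hk⟩

/-- The period of the directed graph of the nonnegative matrix `A`: the greatest common divisor
of the lengths of its closed walks. -/
def matrixPeriod [DecidableEq S] (A : Matrix S S ℝ) : ℕ :=
  sSup {d : ℕ | ∀ (k : ℕ) (i : S), 0 < k → 0 < (A ^ k) i i → d ∣ k}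

end Stochastic

/-! ### Edge-emitting hidden Markov models -/

/-- A finite edge-emitting hidden Markov model with state set `S` and output alphabet `X`;
`T x i j` is the probability of moving from `i` to `j` on the symbol `x`. Every symbol can be
generated from some state. -/
structure EdgeHMM (S X : Type*) [Fintype S] [Fintype X] where
  T : X → Matrix S S ℝ
  nonneg : ∀ x i j, 0 ≤ T x i j
  sum_eq_one : ∀ i, ∑ j, ∑ x, T x i j = 1
  symbol_used : ∀ x, ∃ i, 0 < ∑ j, T x i j

namespace EdgeHMM

variable {S X : Type*} [Fintype S] [Fintype X]

/-- The transition matrix of the underlying Markov chain. -/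
def trans (M : EdgeHMM S X) : Matrix S S ℝ :=
  fun i j => ∑ x, M.T x i j

def IsIrreducible (M : EdgeHMM S X) : Prop :=
  M.trans.IsIrreducible

def period [DecidableEq S] (M : EdgeHMM S X) : ℕ :=
  matrixPeriod M.trans

theorem trans_nonneg (M : EdgeHMM S X) (i j : S) : 0 ≤ M.trans i j :=
  Finset.sum_nonneg fun x _ => M.nonneg x i j

/-- The stationary distribution over the states (unique if `M` is irreducible). -/
def stationary [DecidableEq S] [Nonempty S] (M : EdgeHMM S X) : S → ℝ :=
  Classical.choose (exists_isStationaryDist M.trans_nonneg M.sum_eq_one)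

theorem stationary_spec [DecidableEq S] [Nonempty S] (M : EdgeHMM S X) :
    IsStationaryDist M.trans M.stationary :=
  Classical.choose_spec (exists_isStationaryDist M.trans_nonneg M.sum_eq_one)

/-- `ℙ_μ(S_0^t = s, X_0^{t-1} = w)`, the law of the joint state-symbol sequence with initial
state distribution `μ`. -/
def pathProb (M : EdgeHMM S X) (μ : S → ℝ) {t : ℕ} (s : Fin (t + 1) → S) (w : Fin t → X) : ℝ :=
  μ (s 0) * ∏ k : Fin t, M.T (w k) (s k.castSucc) (s k.succ)

/-- `ℙ_μ(X_0^{t-1} = w)`. -/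
def wordProb (M : EdgeHMM S X) (μ : S → ℝ) {t : ℕ} (w : Fin t → X) : ℝ :=
  ∑ s : Fin (t + 1) → S, M.pathProb μ s w

/-- `ℙ_i(X_0^{t-1} = w, S_t = j)`, where `ℙ_i` starts the model in the state `i`. -/
def stepProb [DecidableEq S] (M : EdgeHMM S X) {t : ℕ} (w : Fin t → X) (i j : S) : ℝ :=
  ∑ s : Fin (t + 1) → S, if s (Fin.last t) = j then M.pathProb (Pi.single i 1) s w else 0

/-- The finite-dimensional laws of the stationary output process. -/
def outputLaw [DecidableEq S] [Nonempty S] (M : EdgeHMM S X) (t : ℕ) (w : Fin t → X) : ℝ :=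
  M.wordProb M.stationary w

/-- The set of states that `i` can move to upon emitting the word `w`. -/
def delta [DecidableEq S] (M : EdgeHMM S X) (i : S) {t : ℕ} (w : Fin t → X) : Set S :=
  {j | 0 < M.stepProb w i j}

def IsPathMergeable [DecidableEq S] (M : EdgeHMM S X) : Prop :=
  ∀ i j : S, i ≠ j → ∃ (t : ℕ) (w : Fin t → X) (k : S), k ∈ M.delta i w ∩ M.delta j w

/-- `x` is a flag symbol for the state `k`. -/
def IsFlagSymbol [DecidableEq S] (M : EdgeHMM S X) (x : X) (k : S) : Prop :=
  ∀ i, (M.delta i ![x]).Nonempty → k ∈ M.delta i ![x]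

def IsFlagState [DecidableEq S] (M : EdgeHMM S X) : Prop :=
  ∀ k, ∃ x, M.IsFlagSymbol x k

/-! #### The convergence rate attached to a choice of flag symbols -/

section Rate

variable [DecidableEq S] [Nonempty S] (M : EdgeHMM S X) (y : S → X)

/-- `p_* = min_j ℙ(X_0 = y_j | S_1 = j)`. -/
def pStar : ℝ :=
  ⨅ j, (∑ i, M.stationary i * M.T (y j) i j) / (∑ i, M.stationary i * M.trans i j)

/-- `q_* = min_j min_i ℙ_i(S_1 = j | X_0 = y_j)`, where `i` ranges over the states that can
generate `y_j`. -/
def qStar : ℝ :=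
  ⨅ j, ⨅ i : {i : S // 0 < ∑ k, M.T (y j) i k}, M.T (y j) i j / ∑ k, M.T (y j) i k

/-- `r_* = min_{i,j} π_i / π_j`. -/
def rStar : ℝ :=
  ⨅ i, ⨅ j, M.stationary i / M.stationary j

def eta : ℝ :=
  M.pStar y * M.rStar / (2 * (Fintype.card S : ℝ))

def alpha₁ : ℝ :=
  Real.exp (-(M.pStar y ^ 2 * M.rStar ^ 2 / (2 * (Fintype.card S : ℝ) ^ 2)))

def alpha₂ : ℝ :=
  (1 - M.qStar y ^ 2) ^ M.eta y

/-- The rate `α = max(α₁, α₂)` for the flag symbols `y_j`, `j ∈ S`. -/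
def flagRate : ℝ :=
  max (M.alpha₁ y) (M.alpha₂ y)

end Rate

/-! #### Block models -/

theorem pathProb_nonneg (M : EdgeHMM S X) {μ : S → ℝ} (hμ : ∀ i, 0 ≤ μ i) {t : ℕ}
    (s : Fin (t + 1) → S) (w : Fin t → X) : 0 ≤ M.pathProb μ s w :=
  mul_nonneg (hμ _) (Finset.prod_nonneg fun _ _ => M.nonneg _ _ _)

theorem stepProb_nonneg [DecidableEq S] (M : EdgeHMM S X) {t : ℕ} (w : Fin t → X) (i j : S) :
    0 ≤ M.stepProb w i j := by
  refine Finset.sum_nonneg fun s _ => ?_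
  split_ifs
  · refine M.pathProb_nonneg (fun l => ?_) s w
    by_cases h : l = i
    · subst h; simp
    · simp [h]
  · exact le_rfl

theorem sum_stepProb [DecidableEq S] (M : EdgeHMM S X) {t : ℕ} (w : Fin t → X) (i : S) :
    ∑ j, M.stepProb w i j = M.wordProb (Pi.single i 1) w := by
  unfold stepProb wordProb
  rw [Finset.sum_comm]
  simp

theorem wordProb_eq_sum [DecidableEq S] (M : EdgeHMM S X) (μ : S → ℝ) {t : ℕ} (w : Fin t → X) :
    M.wordProb μ w = ∑ i, μ i * M.wordProb (Pi.single i 1) w := by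
  simp only [wordProb, Finset.mul_sum]
  rw [Finset.sum_comm]
  refine Finset.sum_congr rfl fun s _ => ?_
  simp [pathProb, Pi.single_apply]

theorem sum_prod_trans (M : EdgeHMM S X) (μ : S → ℝ) (t : ℕ) :
    ∑ s : Fin (t + 1) → S, μ (s 0) * ∏ k : Fin t, M.trans (s k.castSucc) (s k.succ)
      = ∑ i, μ i := by
  induction t with
  | zero =>
    rw [← (Equiv.funUnique (Fin 1) S).symm.sum_comp]
    simp
  | succ t ih =>
    rw [← ih, ← (Fin.snocEquiv (fun _ : Fin (t + 2) => S)).sum_comp, Fintype.sum_prod_type,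
      Finset.sum_comm]
    refine Finset.sum_congr rfl fun s _ => ?_
    have h0 : ∀ j : S, (Fin.snoc (α := fun _ => S) s j : Fin (t + 2) → S) 0 = s 0 := fun j =>
      Fin.snoc_castSucc (α := fun _ => S) j s 0
    simp only [Fin.snocEquiv, Equiv.coe_fn_mk, h0, Fin.prod_univ_castSucc, Fin.succ_last,
      Fin.snoc_last, Fin.snoc_castSucc, ← Fin.castSucc_succ]
    simp only [← mul_assoc, ← Finset.mul_sum]
    have := M.sum_eq_one (s (Fin.last t))
    simp only [trans]
    rw [this, mul_one]

theorem sum_wordProb (M : EdgeHMM S X) (μ : S → ℝ) (t : ℕ) :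
    ∑ w : Fin t → X, M.wordProb μ w = ∑ i, μ i := by
  rw [← M.sum_prod_trans μ t]
  unfold wordProb pathProb
  rw [Finset.sum_comm]
  refine Finset.sum_congr rfl fun s _ => ?_
  rw [← Finset.mul_sum]
  simp only [trans]
  rw [Finset.prod_univ_sum]
  simp

/-- The words of length `n` of positive probability in the stationary output process. -/
def BlockAlphabet [DecidableEq S] [Nonempty S] (M : EdgeHMM S X) (n : ℕ) : Type _ :=
  {w : Fin n → X // 0 < M.outputLaw n w}

instance [DecidableEq S] [Nonempty S] (M : EdgeHMM S X) (n : ℕ) : Fintype (M.BlockAlphabet n) :=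
  Fintype.ofInjective (fun w : M.BlockAlphabet n => w.1) Subtype.val_injective

theorem wordProb_single_eq_zero [DecidableEq S] [Nonempty S] (M : EdgeHMM S X)
    (hM : M.IsIrreducible) {n : ℕ} {w : Fin n → X} (hw : ¬ 0 < M.outputLaw n w) (i : S) :
    M.wordProb (Pi.single i 1) w = 0 := by
  have hnn : ∀ l, 0 ≤ M.wordProb (Pi.single l 1) w := fun l => by
    rw [← M.sum_stepProb]
    exact Finset.sum_nonneg fun j _ => M.stepProb_nonneg w l j
  by_contra hne
  apply hw
  unfold outputLaw
  rw [M.wordProb_eq_sum]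
  exact Finset.sum_pos' (fun l _ => mul_nonneg (M.stationary_spec.1 l) (hnn l))
    ⟨i, Finset.mem_univ _,
      mul_pos (M.stationary_spec.pos hM i) (lt_of_le_of_ne (hnn i) (Ne.symm hne))⟩

/-- The block model `M^n`: its symbols are the length-`n` words of positive probability, and
its transition probabilities are the `n`-step transition probabilities of `M` on those words. -/
def blockModel [DecidableEq S] [Nonempty S] (M : EdgeHMM S X) (hM : M.IsIrreducible) (n : ℕ) :
    EdgeHMM S (M.BlockAlphabet n) where
  T w i j := M.stepProb w.1 i j
  nonneg w i j := M.stepProb_nonneg w.1 i j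
  sum_eq_one i := by
    rw [Finset.sum_comm]
    simp only [M.sum_stepProb]
    have h1 : ∑ w : Fin n → X, M.wordProb (Pi.single i 1) w = 1 := by
      rw [M.sum_wordProb]; simp
    refine Eq.trans ?_ h1
    refine Finset.sum_of_injOn (fun w : M.BlockAlphabet n => w.1)
      (fun a _ b _ h => Subtype.val_injective h) (fun _ _ => by simp) ?_ (fun _ _ => rfl)
    intro w _ hw
    apply M.wordProb_single_eq_zero hM
    intro hpos
    exact hw ⟨⟨w, hpos⟩, Finset.mem_coe.2 (Finset.mem_univ _), rfl⟩
  symbol_used w := by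
    by_contra! hcon
    have hw := w.2
    unfold outputLaw at hw
    rw [M.wordProb_eq_sum] at hw
    refine absurd hw (not_lt.2 (Finset.sum_nonpos fun i _ => ?_))
    rw [← M.sum_stepProb]
    exact mul_nonpos_of_nonneg_of_nonpos (M.stationary_spec.1 i) (hcon i)

end EdgeHMM

/-! ### State-emitting hidden Markov models -/

/-- A finite state-emitting hidden Markov model with stochastic transition matrix `T` and
stochastic observation matrix `O`. Every symbol can be generated from some state. -/
structure StateHMM (S X : Type*) [Fintype S] [Fintype X] where
  T : Matrix S S ℝ
  O : Matrix S X ℝ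
  T_nonneg : ∀ i j, 0 ≤ T i j
  T_sum : ∀ i, ∑ j, T i j = 1
  O_nonneg : ∀ i x, 0 ≤ O i x
  O_sum : ∀ i, ∑ x, O i x = 1
  symbol_used : ∀ x, ∃ i, 0 < O i x

namespace StateHMM

variable {S X : Type*} [Fintype S] [Fintype X]

def IsIrreducible (M : StateHMM S X) : Prop :=
  M.T.IsIrreducible

/-- The stationary distribution over the states (unique if `M` is irreducible). -/
def stationary [DecidableEq S] [Nonempty S] (M : StateHMM S X) : S → ℝ :=
  Classical.choose (exists_isStationaryDist M.T_nonneg M.T_sum)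

/-- `ℙ_μ(S_0^t = s, X_1^t = w)`, where `S_0` has distribution `μ`. -/
def pathProb (M : StateHMM S X) (μ : S → ℝ) {t : ℕ} (s : Fin (t + 1) → S) (w : Fin t → X) : ℝ :=
  μ (s 0) * ∏ k : Fin t, (M.T (s k.castSucc) (s k.succ) * M.O (s k.succ) (w k))

/-- `ℙ_μ(X_1^t = w)`. -/
def wordProb (M : StateHMM S X) (μ : S → ℝ) {t : ℕ} (w : Fin t → X) : ℝ :=
  ∑ s : Fin (t + 1) → S, M.pathProb μ s w

/-- `ℙ_i(X_1^t = w, S_t = j)`, where `ℙ_i` starts the model in the state `i`. -/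
def stepProb [DecidableEq S] (M : StateHMM S X) {t : ℕ} (w : Fin t → X) (i j : S) : ℝ :=
  ∑ s : Fin (t + 1) → S, if s (Fin.last t) = j then M.pathProb (Pi.single i 1) s w else 0

/-- The finite-dimensional laws of the stationary output process. -/
def outputLaw [DecidableEq S] [Nonempty S] (M : StateHMM S X) (t : ℕ) (w : Fin t → X) : ℝ :=
  M.wordProb M.stationary w

/-- The set of states that `i` can move to upon emitting the word `w`. -/
def delta [DecidableEq S] (M : StateHMM S X) (i : S) {t : ℕ} (w : Fin t → X) : Set S :=
  {j | 0 < M.stepProb w i j}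

def IsPathMergeable [DecidableEq S] (M : StateHMM S X) : Prop :=
  ∀ i j : S, i ≠ j → ∃ (t : ℕ) (w : Fin t → X) (k : S), k ∈ M.delta i w ∩ M.delta j w

/-- The edge-emitting model with `T'^(x) i j = T i j * O j x`. -/
def toEdge [DecidableEq S] (M : StateHMM S X) (hM : M.IsIrreducible) : EdgeHMM S X where
  T x i j := M.T i j * M.O j x
  nonneg x i j := mul_nonneg (M.T_nonneg i j) (M.O_nonneg j x)
  sum_eq_one i := by simp only [← Finset.mul_sum, M.O_sum, mul_one, M.T_sum]
  symbol_used x := by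
    obtain ⟨j, hj⟩ := M.symbol_used x
    have hin : ∃ i, 0 < M.T i j := by
      obtain ⟨k, hk, hpos⟩ := (Matrix.isIrreducible_iff_exists_pow_pos hM.nonneg).1 hM j j
      by_contra! hcon
      obtain ⟨m, rfl⟩ := Nat.exists_eq_succ_of_ne_zero hk.ne'
      rw [pow_succ, Matrix.mul_apply] at hpos
      refine absurd hpos (not_lt.2 (Finset.sum_nonpos fun l _ => ?_))
      exact mul_nonpos_of_nonneg_of_nonpos (Matrix.pow_apply_nonneg hM.nonneg m j l) (hcon l)
    obtain ⟨i, hi⟩ := hin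
    exact ⟨i, Finset.sum_pos' (fun l _ => mul_nonneg (M.T_nonneg i l) (M.O_nonneg l x))
      ⟨j, Finset.mem_univ _, mul_pos hi hj⟩⟩

theorem toEdge_isIrreducible [DecidableEq S] (M : StateHMM S X) (hM : M.IsIrreducible) :
    (M.toEdge hM).IsIrreducible := by
  have h : (M.toEdge hM).trans = M.T := by
    ext i j
    simp only [EdgeHMM.trans, toEdge, ← Finset.mul_sum, M.O_sum, mul_one]
  unfold EdgeHMM.IsIrreducible
  rw [h]
  exact hM

end StateHMM

end

/-!
The estimates `h(t+1)` of a stationary process decrease, and by the chain rule and Cesàro averaging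
their limit is the entropy rate `h`. For a hidden Markov model, `h` is at least the conditional
entropy of the next symbol given the last `t` symbols *and* the state before them
(`EdgeHMM.le_entropyRate`). Hence `h(t+1) - h` is at most the mutual information of the next symbol
and that state, given the word `w` of the last `t` symbols. This is a defect of superadditivity of
the unnormalized entropy, and `rawEntropy_sum_sub_le` bounds it by a constant times the average
over `w` of the spread, over the initial states `i`, of the predictive probabilities
`ℙ_i(X_t = x | w)`. The bound is linear in the spread, without a logarithmic loss.

The spread contracts when blocks are put in front of `w` (`EdgeHMM.PredictionGap.append`).
Conditionally on the word, the states form an inhomogeneous Markov chain, so another block can only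
average the predictions. Let `k` be the state from which `w` is most likely. If the new block is a
flag word `y_k`, then from every state that can generate the block the conditional probability of
moving to `k` is at least `q_*`, even given the future `w`, and the spread shrinks by the factor
`1 - q_*`. The choice of `k` also makes its conditional probability given `w` at least
`r_* / |S|`, so `y_k` precedes `w` with probability at least `p = p_* r_* / |S|`. On average, a
block of length `n` therefore contracts the spread by `1 - p q_*`, and `one_sub_mul_le_max` shows
that this is at most `α`.

The quantities `p_*` and `r_*` refer to the stationary distribution of the block model, which is
that of the original model because `T ^ n` is irreducible for `n` coprime to the period
(`Matrix.IsIrreducible.pow`). For a path-mergeable model, merging the states one after the other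
gives a flag word for one state, hence for every state. Flag words survive the addition of symbols
in front, so they can be given any common large length. A state-emitting model has the same output
process and the same word probabilities as its edge-emitting version.
-/

noncomputable section

/-! ### Unnormalized entropy -/

section RawEntropy

variable {A ι : Type*} [Fintype A] [Fintype ι]

/-- The entropy of a nonnegative vector `p`, extended from probability vectors by homogeneity of
degree one. Conditional entropies are sums of such terms, and the functional is superadditive. -/
def rawEntropy (p : A → ℝ) : ℝ :=
  (∑ a, p a) * entropy (fun a => p a / ∑ a', p a')

theorem rawEntropy_eq {p : A → ℝ} (hp : ∀ a, 0 ≤ p a) :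
    rawEntropy p = -∑ a, p a * Real.logb 2 (p a / ∑ a', p a') := by
  unfold rawEntropy entropy
  rw [mul_neg, Finset.mul_sum]
  congr 1
  refine Finset.sum_congr rfl fun a _ => ?_
  rcases eq_or_ne (∑ a', p a') 0 with h | h
  · have := (Finset.sum_eq_zero_iff_of_nonneg fun a _ => hp a).1 h a (Finset.mem_univ a)
    simp [this]
  · rw [← mul_assoc, mul_div_cancel₀ _ h]

theorem rawEntropy_eq_sub {p : A → ℝ} (hp : ∀ a, 0 ≤ p a) :
    rawEntropy p =
      (∑ a, p a) * Real.logb 2 (∑ a, p a) - ∑ a, p a * Real.logb 2 (p a) := by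
  rw [rawEntropy_eq hp, Finset.sum_mul, ← Finset.sum_sub_distrib, ← Finset.sum_neg_distrib]
  refine Finset.sum_congr rfl fun a _ => ?_
  rcases eq_or_ne (p a) 0 with h | h
  · simp [h]
  · have h' : ∑ a', p a' ≠ 0 := fun h0 =>
      h ((Finset.sum_eq_zero_iff_of_nonneg fun a _ => hp a).1 h0 a (Finset.mem_univ a))
    rw [Real.logb_div h h']
    ring

theorem rawEntropy_nonneg {p : A → ℝ} (hp : ∀ a, 0 ≤ p a) : 0 ≤ rawEntropy p := by
  rw [rawEntropy_eq hp, ← Finset.sum_neg_distrib]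
  refine Finset.sum_nonneg fun a _ => ?_
  have hle : p a ≤ ∑ a', p a' := Finset.single_le_sum (fun a _ => hp a) (Finset.mem_univ a)
  have : Real.logb 2 (p a / ∑ a', p a') ≤ 0 :=
    Real.logb_nonpos one_lt_two (div_nonneg (hp a) ((hp a).trans hle))
      (div_le_one_of_le₀ hle ((hp a).trans hle))
  nlinarith [hp a]

theorem rawEntropy_smul {c : ℝ} (p : A → ℝ) :
    rawEntropy (fun a => c * p a) = c * rawEntropy p := by
  rcases eq_or_ne c 0 with rfl | hc
  · simp [rawEntropy]
  · unfold rawEntropy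
    simp only [← Finset.mul_sum]
    rw [mul_assoc]
    congr 3
    ext a
    rw [mul_div_mul_left _ _ hc]

theorem sub_mul_logb_le {x y z : ℝ} (hx : 0 < x) (hy : 0 < y) (hz : 0 ≤ z) :
    z * (Real.logb 2 x - Real.logb 2 y) ≤ z * (x / y - 1) / Real.log 2 := by
  rw [← Real.logb_div hx.ne' hy.ne', mul_div_assoc]
  refine mul_le_mul_of_nonneg_left ?_ hz
  exact div_le_div_of_nonneg_right (Real.log_le_sub_one_of_pos (div_pos hx hy))
    (Real.log_pos one_lt_two).le

/-- Gibbs' inequality in unnormalized form. -/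
theorem rawEntropy_le_cross {p q : A → ℝ} (hp : ∀ a, 0 ≤ p a) (hpq : ∀ a, p a ≤ q a) :
    rawEntropy p ≤ -∑ a, p a * Real.logb 2 (q a / ∑ a', q a') := by
  rw [rawEntropy_eq hp, neg_le_neg_iff, ← sub_nonpos, ← Finset.sum_sub_distrib]
  set m := ∑ a', p a' with hm
  set n := ∑ a', q a' with hn
  have hq : ∀ a, 0 ≤ q a := fun a => (hp a).trans (hpq a)
  have hlog : 0 < Real.log 2 := Real.log_pos one_lt_two
  have hm0 : 0 ≤ m := Finset.sum_nonneg fun a _ => hp a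
  calc ∑ a, (p a * Real.logb 2 (q a / n) - p a * Real.logb 2 (p a / m))
      ≤ ∑ a, (m * (q a / n) - p a) / Real.log 2 := by
        refine Finset.sum_le_sum fun a _ => ?_
        rcases (hp a).eq_or_lt with h | h
        · rw [← h]
          have := hq a
          have hn0 : 0 ≤ n := Finset.sum_nonneg fun a _ => hq a
          simp only [zero_mul, sub_zero]
          positivity
        · have hma : 0 < m :=
            h.trans_le (Finset.single_le_sum (fun a _ => hp a) (Finset.mem_univ a))
          have hqa : 0 < q a := h.trans_le (hpq a)
          have hna : 0 < n :=
            hqa.trans_le (Finset.single_le_sum (fun a _ => hq a) (Finset.mem_univ a))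
          rw [← mul_sub]
          refine (sub_mul_logb_le (by positivity) (by positivity) (hp a)).trans (le_of_eq ?_)
          field_simp
    _ = (m * (n / n) - m) / Real.log 2 := by
        rw [← Finset.sum_div, Finset.sum_sub_distrib, ← Finset.mul_sum, ← Finset.sum_div]
    _ ≤ 0 := by
        refine div_nonpos_of_nonpos_of_nonneg ?_ hlog.le
        have := mul_le_of_le_one_right hm0 (div_self_le_one n)
        linarith

theorem rawEntropy_superadditive {p : ι → A → ℝ} (hp : ∀ i a, 0 ≤ p i a) :
    ∑ i, rawEntropy (p i) ≤ rawEntropy (fun a => ∑ i, p i a) := by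
  rw [rawEntropy_eq fun a => Finset.sum_nonneg fun i _ => hp i a]
  simp only [Finset.sum_mul]
  rw [Finset.sum_comm, ← Finset.sum_neg_distrib]
  refine Finset.sum_le_sum fun i _ => rawEntropy_le_cross (hp i) fun a => ?_
  exact Finset.single_le_sum (fun i _ => hp i a) (Finset.mem_univ i)

/-- A quantitative converse of superadditivity. If the conditional laws `p i / ∑ a, p i a` of the
components differ in the coordinate `a` by at most `d a`, the defect of superadditivity is linear
in `d`: it is a sum of relative entropies, and `log z ≤ z - 1` bounds each of these by a
`χ²`-type expression in which one factor `d a` is kept and the other one is absorbed by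
`p i a ≤ ∑ i, p i a`. -/
theorem rawEntropy_sum_sub_le {p : ι → A → ℝ} (hp : ∀ i a, 0 ≤ p i a) {c d : A → ℝ}
    (hd : ∀ a, 0 ≤ d a) (hl : ∀ i a, c a * ∑ a', p i a' ≤ p i a)
    (hu : ∀ i a, p i a ≤ (c a + d a) * ∑ a', p i a') :
    rawEntropy (fun a => ∑ i, p i a) - ∑ i, rawEntropy (p i) ≤
      Fintype.card ι / Real.log 2 * ((∑ i, ∑ a, p i a) * ∑ a, d a) := by
  have hlog : 0 < Real.log 2 := Real.log_pos one_lt_two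
  have hq0 : ∀ a, 0 ≤ ∑ i, p i a := fun a => Finset.sum_nonneg fun i _ => hp i a
  rw [rawEntropy_eq hq0, Finset.sum_congr rfl fun i _ => rawEntropy_eq (hp i)]
  rw [show ∑ a, ∑ i, p i a = ∑ i, ∑ a, p i a from Finset.sum_comm]
  set m := ∑ i, ∑ a, p i a with hm
  have hmi : ∀ i, 0 ≤ ∑ a, p i a := fun i => Finset.sum_nonneg fun a _ => hp i a
  have hm0 : 0 ≤ m := Finset.sum_nonneg fun i _ => hmi i
  have key : ∀ i a, p i a * (Real.logb 2 (p i a / ∑ a', p i a') -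
      Real.logb 2 ((∑ i', p i' a) / m)) ≤ m * d a / Real.log 2 := by
    intro i a
    rcases (hp i a).eq_or_lt with h | h
    · rw [← h, zero_mul]
      exact div_nonneg (mul_nonneg hm0 (hd a)) hlog.le
    · have hmia : 0 < ∑ a', p i a' :=
        h.trans_le (Finset.single_le_sum (fun a _ => hp i a) (Finset.mem_univ a))
      have hle : p i a ≤ ∑ i', p i' a :=
        Finset.single_le_sum (fun i _ => hp i a) (Finset.mem_univ i)
      have hqa : 0 < ∑ i', p i' a := h.trans_le hle
      have hma : 0 < m :=
        hmia.trans_le (Finset.single_le_sum (fun i _ => hmi i) (Finset.mem_univ i))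
      refine (sub_mul_logb_le (by positivity) (by positivity) (hp i a)).trans ?_
      refine div_le_div_of_nonneg_right ?_ hlog.le
      have hcq : c a * m ≤ ∑ i', p i' a := by
        rw [hm, Finset.mul_sum]
        exact Finset.sum_le_sum fun i _ => hl i a
      have h1 : p i a * m - (∑ a', p i a') * ∑ i', p i' a ≤ d a * m * ∑ a', p i a' := by
        have h2 := mul_le_mul_of_nonneg_right (hu i a) hm0
        have h3 := mul_le_mul_of_nonneg_left hcq hmia.le
        linarith
      calc p i a * (p i a / (∑ a', p i a') / ((∑ i', p i' a) / m) - 1)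
          = p i a / (∑ i', p i' a) *
            ((p i a * m - (∑ a', p i a') * ∑ i', p i' a) / ∑ a', p i a') := by
            field_simp
        _ ≤ p i a / (∑ i', p i' a) * (d a * m) := by
            refine mul_le_mul_of_nonneg_left ?_ (by positivity)
            rwa [div_le_iff₀ hmia]
        _ ≤ 1 * (d a * m) :=
            mul_le_mul_of_nonneg_right (div_le_one_of_le₀ hle hqa.le) (mul_nonneg (hd a) hm0)
        _ = m * d a := by ring
  calc _ = ∑ i, ∑ a, p i a * (Real.logb 2 (p i a / ∑ a', p i a') -
      Real.logb 2 ((∑ i', p i' a) / m)) := by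
        simp only [mul_sub, Finset.sum_sub_distrib, Finset.sum_neg_distrib, Finset.sum_mul]
        rw [Finset.sum_comm (f := fun a i => p i a * Real.logb 2 ((∑ i', p i' a) / m))]
        ring
    _ ≤ ∑ i : ι, ∑ a, m * d a / Real.log 2 :=
        Finset.sum_le_sum fun i _ => Finset.sum_le_sum fun a _ => key i a
    _ = _ := by
        rw [Finset.sum_const, ← Finset.sum_div, ← Finset.mul_sum, nsmul_eq_mul, Finset.card_univ]
        ring

end RawEntropy

/-! ### Block entropies of stationary processes -/

section StationaryLaw

variable {X : Type*} [Fintype X]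

/-- `P` is the family of finite-dimensional laws of a stationary process: the laws are consistent
both when the last and when the first symbol is summed out. -/
structure IsStationaryLaw (P : ∀ t : ℕ, (Fin t → X) → ℝ) : Prop where
  nonneg : ∀ t w, 0 ≤ P t w
  zero : ∀ w, P 0 w = 1
  sum_snoc : ∀ t (w : Fin t → X), ∑ x, P (t + 1) (Fin.snoc (α := fun _ => X) w x) = P t w
  sum_cons : ∀ t (w : Fin t → X), ∑ x, P (t + 1) (Fin.cons (α := fun _ => X) x w) = P t w

theorem blockEstimate_succ (P : ∀ t : ℕ, (Fin t → X) → ℝ) (t : ℕ) :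
    blockEstimate P (t + 1) =
      ∑ w : Fin t → X, rawEntropy fun x => P (t + 1) (Fin.snoc (α := fun _ => X) w x) :=
  rfl

theorem sum_fin_snoc {t : ℕ} (f : (Fin (t + 1) → X) → ℝ) :
    ∑ w, f w = ∑ w : Fin t → X, ∑ x, f (Fin.snoc (α := fun _ => X) w x) := by
  rw [← (Fin.snocEquiv (fun _ : Fin (t + 1) => X)).sum_comp, Fintype.sum_prod_type,
    Finset.sum_comm]
  rfl

theorem sum_fin_cons {t : ℕ} (f : (Fin (t + 1) → X) → ℝ) :
    ∑ w, f w = ∑ w : Fin t → X, ∑ x, f (Fin.cons (α := fun _ => X) x w) := by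
  rw [← (Fin.consEquiv (fun _ : Fin (t + 1) => X)).sum_comp, Fintype.sum_prod_type,
    Finset.sum_comm]
  rfl

namespace IsStationaryLaw

variable {P : ∀ t : ℕ, (Fin t → X) → ℝ}

/-- The chain rule. -/
theorem blockEntropy_succ (hP : IsStationaryLaw P) (t : ℕ) :
    blockEntropy P (t + 1) = blockEntropy P t + blockEstimate P (t + 1) := by
  rw [blockEstimate_succ, Finset.sum_congr rfl fun w _ => rawEntropy_eq_sub fun x => hP.nonneg _ _]
  simp only [hP.sum_snoc, Finset.sum_sub_distrib]
  rw [← sum_fin_snoc fun w => P (t + 1) w * Real.logb 2 (P (t + 1) w)]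
  simp only [blockEntropy, entropy]
  ring

theorem blockEstimate_antitone (hP : IsStationaryLaw P) :
    Antitone fun t => blockEstimate P (t + 1) := by
  refine antitone_nat_of_succ_le fun t => ?_
  rw [blockEstimate_succ, blockEstimate_succ, sum_fin_cons]
  refine Finset.sum_le_sum fun w _ => ?_
  have h := rawEntropy_superadditive (p := fun (a x : X) =>
    P (t + 1 + 1) (Fin.snoc (α := fun _ => X) (Fin.cons (α := fun _ => X) a w) x))
    fun _ _ => hP.nonneg _ _
  refine h.trans (le_of_eq ?_)
  congr 1
  ext x
  rw [← hP.sum_cons]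
  refine Finset.sum_congr rfl fun a _ => ?_
  rw [Fin.cons_snoc_eq_snoc_cons]

theorem blockEstimate_nonneg (hP : IsStationaryLaw P) (t : ℕ) : 0 ≤ blockEstimate P (t + 1) := by
  rw [blockEstimate_succ]
  exact Finset.sum_nonneg fun w _ => rawEntropy_nonneg fun x => hP.nonneg _ _

theorem blockEntropy_eq_sum (hP : IsStationaryLaw P) (t : ℕ) :
    blockEntropy P t = ∑ s ∈ Finset.range t, blockEstimate P (s + 1) := by
  induction t with
  | zero => simp [blockEntropy, entropy, hP.zero]
  | succ t ih => rw [hP.blockEntropy_succ, ih, Finset.sum_range_succ]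

/-- The entropy rate exists and is also the limit of the estimates `h(t)`. -/
theorem tendsto_blockEntropy_and_blockEstimate (hP : IsStationaryLaw P) :
    Tendsto (fun t : ℕ => blockEntropy P t / (t : ℝ)) atTop (𝓝 (entropyRate P)) ∧
      Tendsto (fun t => blockEstimate P (t + 1)) atTop (𝓝 (entropyRate P)) := by
  have h1 := tendsto_atTop_ciInf hP.blockEstimate_antitone
    ⟨0, by rintro _ ⟨t, rfl⟩; exact hP.blockEstimate_nonneg t⟩
  have h2 : Tendsto (fun t : ℕ => blockEntropy P t / (t : ℝ)) atTop
      (𝓝 (⨅ t, blockEstimate P (t + 1))) := by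
    refine h1.cesaro.congr fun t => ?_
    rw [hP.blockEntropy_eq_sum, div_eq_inv_mul]
  have h3 : entropyRate P = ⨅ t, blockEstimate P (t + 1) := h2.limUnder_eq
  rw [h3]
  exact ⟨h2, h1⟩

theorem entropyRate_le (hP : IsStationaryLaw P) {t : ℕ} (ht : 1 ≤ t) :
    entropyRate P ≤ blockEstimate P t := by
  obtain ⟨t, rfl⟩ := Nat.exists_eq_add_of_le' ht
  exact hP.blockEstimate_antitone.le_of_tendsto hP.tendsto_blockEntropy_and_blockEstimate.2 t

/-- A geometric bound on `h(t) - h` bounds the convergence rate; constants disappear in the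
`t`-th root. -/
theorem convergenceRate_le (hP : IsStationaryLaw P) {C β : ℝ} (hβ : 0 < β)
    (h : ∀ t, blockEstimate P (t + 1) - entropyRate P ≤ C * β ^ (t + 1)) :
    convergenceRate P ≤ (β : EReal) := by
  set D := max C 1 with hD
  have hD0 : 0 < D := lt_max_of_lt_right one_pos
  have hlim : Tendsto (fun t : ℕ => ((D ^ (1 / (t : ℝ)) * β : ℝ) : EReal)) atTop
      (𝓝 (β : EReal)) := by
    refine (continuous_coe_real_ereal.tendsto _).comp ?_
    have h0 : Tendsto (fun t : ℕ => D ^ (1 / (t : ℝ))) atTop (𝓝 (D ^ (0 : ℝ))) :=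
      (Real.continuousAt_const_rpow hD0.ne').tendsto.comp tendsto_one_div_atTop_nhds_zero_nat
    simpa using h0.mul_const β
  unfold convergenceRate
  rw [← hlim.limsup_eq]
  refine limsup_le_limsup ?_
  filter_upwards [eventually_ge_atTop 1] with t ht
  have h0 := hP.entropyRate_le ht
  obtain ⟨s, rfl⟩ := Nat.exists_eq_add_of_le' ht
  rw [EReal.coe_le_coe_iff]
  have hne : ((s + 1 : ℕ) : ℝ) ≠ 0 := by positivity
  calc (blockEstimate P (s + 1) - entropyRate P) ^ (1 / ((s + 1 : ℕ) : ℝ))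
      ≤ (D * β ^ (s + 1)) ^ (1 / ((s + 1 : ℕ) : ℝ)) := by
        refine Real.rpow_le_rpow (sub_nonneg.2 h0) ((h s).trans ?_) (by positivity)
        exact mul_le_mul_of_nonneg_right (le_max_left _ _) (by positivity)
    _ = D ^ (1 / ((s + 1 : ℕ) : ℝ)) * β := by
        rw [Real.mul_rpow hD0.le (by positivity), one_div,
          Real.pow_rpow_inv_natCast hβ.le (by simp)]

end IsStationaryLaw

end StationaryLaw

/-! ### Weighted averages -/

/-- A weighted average, one of whose weights is at least a fraction `θ` of the total, is confined
to an interval shrunk by the factor `1 - θ` towards the corresponding value. -/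
theorem weighted_average_bounds {S : Type*} [Fintype S] {B v g : S → ℝ} {c d θ : ℝ}
    (hB : ∀ j, 0 ≤ B j) (hl : ∀ j, c * v j ≤ g j) (hu : ∀ j, g j ≤ (c + d) * v j) {k : S} {e : ℝ}
    (he : g k = e * v k) (hk : θ * ∑ j, B j * v j ≤ B k * v k) (hce : c ≤ e) (hec : e ≤ c + d) :
    (θ * e + (1 - θ) * c) * ∑ j, B j * v j ≤ ∑ j, B j * g j ∧
      ∑ j, B j * g j ≤ (θ * e + (1 - θ) * c + (1 - θ) * d) * ∑ j, B j * v j := by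
  classical
  have hsplit : ∀ f : S → ℝ, ∑ j, B j * f j = B k * f k + ∑ j ∈ Finset.univ.erase k, B j * f j :=
    fun f => (Finset.add_sum_erase _ _ (Finset.mem_univ k)).symm
  set R := ∑ j ∈ Finset.univ.erase k, B j * v j with hR
  have h1 : c * R ≤ ∑ j ∈ Finset.univ.erase k, B j * g j := by
    rw [hR, Finset.mul_sum]
    refine Finset.sum_le_sum fun j _ => ?_
    have := mul_le_mul_of_nonneg_left (hl j) (hB j)
    linarith
  have h2 : ∑ j ∈ Finset.univ.erase k, B j * g j ≤ (c + d) * R := by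
    rw [hR, Finset.mul_sum]
    refine Finset.sum_le_sum fun j _ => ?_
    have := mul_le_mul_of_nonneg_left (hu j) (hB j)
    linarith
  rw [hsplit v] at hk ⊢
  rw [hsplit g, he]
  constructor <;> nlinarith [mul_nonneg (sub_nonneg.2 hce) (sub_nonneg.2 hk),
    mul_nonneg (sub_nonneg.2 hec) (sub_nonneg.2 hk)]

/-! ### Words as products of transition matrices -/

theorem IsStationaryDist.vecMul_pow {S : Type*} [Fintype S] [DecidableEq S] {A : Matrix S S ℝ}
    {p : S → ℝ} (hp : IsStationaryDist A p) (n : ℕ) : Matrix.vecMul p (A ^ n) = p := by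
  induction n with
  | zero => simp
  | succ n ih => rw [pow_succ, ← Matrix.vecMul_vecMul, ih, hp.2.2]

theorem sum_fin_append {X : Type*} [Fintype X] {m t : ℕ} (f : (Fin (m + t) → X) → ℝ) :
    ∑ w, f w = ∑ w : Fin t → X, ∑ u : Fin m → X, f (Fin.append u w) := by
  rw [← (Fin.appendEquiv m t).sum_comp, Fintype.sum_prod_type, Finset.sum_comm]
  rfl

namespace EdgeHMM

variable {S X : Type*} [Fintype S] [Fintype X] [DecidableEq S]

/-- The matrix of the probabilities `ℙ_i(X_0^{t-1} = w, S_t = j)`. -/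
def wordMatrix (M : EdgeHMM S X) {t : ℕ} (w : Fin t → X) : Matrix S S ℝ :=
  (List.ofFn fun k => M.T (w k)).prod

variable (M : EdgeHMM S X)

theorem wordMatrix_zero (w : Fin 0 → X) : M.wordMatrix w = 1 := by
  simp [wordMatrix]

theorem wordMatrix_snoc {t : ℕ} (w : Fin t → X) (x : X) :
    M.wordMatrix (Fin.snoc (α := fun _ => X) w x) = M.wordMatrix w * M.T x := by
  rw [wordMatrix, List.ofFn_succ_last]
  simp [wordMatrix]

theorem wordMatrix_append {s t : ℕ} (u : Fin s → X) (w : Fin t → X) :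
    M.wordMatrix (Fin.append u w) = M.wordMatrix u * M.wordMatrix w := by
  simp only [wordMatrix]
  rw [← List.prod_append]
  congr 1
  rw [← List.ofFn_fin_append]
  congr 1
  ext k : 1
  refine Fin.addCases (fun i => ?_) (fun i => ?_) k <;> simp

theorem wordMatrix_cons {t : ℕ} (x : X) (w : Fin t → X) :
    M.wordMatrix (Fin.cons (α := fun _ => X) x w) = M.T x * M.wordMatrix w := by
  simp [wordMatrix, List.ofFn_succ]

theorem wordMatrix_nonneg {t : ℕ} (w : Fin t → X) (i j : S) : 0 ≤ M.wordMatrix w i j := by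
  induction t generalizing i j with
  | zero =>
    rw [wordMatrix_zero, Matrix.one_apply]
    split_ifs <;> norm_num
  | succ t ih =>
    rw [← Fin.snoc_init_self w, wordMatrix_snoc, Matrix.mul_apply]
    exact Finset.sum_nonneg fun k _ => mul_nonneg (ih _ _ _) (M.nonneg _ _ _)

theorem sum_wordMatrix (t : ℕ) : ∑ w : Fin t → X, M.wordMatrix w = M.trans ^ t := by
  have hT : ∑ x, M.T x = M.trans := by
    ext i j
    simp [trans, Matrix.sum_apply]
  induction t with
  | zero => simp [wordMatrix_zero]
  | succ t ih =>
    rw [pow_succ, ← ih, ← hT, Matrix.sum_mul,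
      ← (Fin.snocEquiv (fun _ : Fin (t + 1) => X)).sum_comp, Fintype.sum_prod_type,
      Finset.sum_comm]
    refine Finset.sum_congr rfl fun w _ => ?_
    rw [Matrix.mul_sum]
    exact Finset.sum_congr rfl fun x _ => M.wordMatrix_snoc w x

theorem sum_pathProb_last (μ : S → ℝ) {t : ℕ} (w : Fin t → X) (j : S) :
    (∑ s : Fin (t + 1) → S, if s (Fin.last t) = j then M.pathProb μ s w else 0) =
      Matrix.vecMul μ (M.wordMatrix w) j := by
  induction t generalizing j with
  | zero =>
    rw [← (Equiv.funUnique (Fin 1) S).symm.sum_comp]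
    simp [pathProb, wordMatrix_zero]
  | succ t ih =>
    rw [← Fin.snoc_init_self w, wordMatrix_snoc, ← Matrix.vecMul_vecMul]
    set v : Fin t → X := Fin.init w
    set x : X := w (Fin.last t)
    have hR : Matrix.vecMul (Matrix.vecMul μ (M.wordMatrix v)) (M.T x) j =
        ∑ i, Matrix.vecMul μ (M.wordMatrix v) i * M.T x i j := rfl
    rw [hR]
    simp only [← ih, Finset.sum_mul]
    rw [Finset.sum_comm, ← (Fin.snocEquiv (fun _ : Fin (t + 2) => S)).sum_comp,
      Fintype.sum_prod_type, Finset.sum_comm]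
    refine Finset.sum_congr rfl fun s _ => ?_
    have h0 : ∀ j : S, (Fin.snoc (α := fun _ => S) s j : Fin (t + 2) → S) 0 = s 0 := fun j =>
      Fin.snoc_castSucc (α := fun _ => S) j s 0
    simp only [Fin.snocEquiv, Equiv.coe_fn_mk, Fin.snoc_last, pathProb, h0,
      Fin.prod_univ_castSucc, Fin.succ_last, Fin.snoc_castSucc, ← Fin.castSucc_succ, ite_mul,
      zero_mul, Finset.sum_ite_eq, Finset.sum_ite_eq', Finset.mem_univ, if_true, mul_assoc]

theorem stepProb_eq {t : ℕ} (w : Fin t → X) (i j : S) : M.stepProb w i j = M.wordMatrix w i j := by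
  rw [stepProb, sum_pathProb_last, Matrix.single_one_vecMul]
  rfl

/-- `ℙ_i(X_0^{t-1} = w)`. -/
def probFrom {t : ℕ} (w : Fin t → X) (i : S) : ℝ :=
  ∑ j, M.wordMatrix w i j

theorem probFrom_nonneg {t : ℕ} (w : Fin t → X) (i : S) : 0 ≤ M.probFrom w i :=
  Finset.sum_nonneg fun j _ => M.wordMatrix_nonneg w i j

theorem sum_mul_probFrom {t : ℕ} (A : Matrix S S ℝ) (w : Fin t → X) (i : S) :
    ∑ j, (A * M.wordMatrix w) i j = ∑ j, A i j * M.probFrom w j := by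
  simp only [Matrix.mul_apply, probFrom, Finset.mul_sum]
  exact Finset.sum_comm

theorem probFrom_append {s t : ℕ} (u : Fin s → X) (w : Fin t → X) (i : S) :
    M.probFrom (Fin.append u w) i = ∑ j, M.wordMatrix u i j * M.probFrom w j := by
  rw [← sum_mul_probFrom, ← wordMatrix_append]
  rfl

theorem sum_probFrom_snoc {t : ℕ} (w : Fin t → X) (i : S) :
    ∑ x, M.probFrom (Fin.snoc (α := fun _ => X) w x) i = M.probFrom w i := by
  simp only [probFrom, wordMatrix_snoc, Matrix.mul_apply]
  rw [Finset.sum_comm]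
  have h : ∀ k, ∑ j, ∑ x, M.T x k j = 1 := M.sum_eq_one
  calc ∑ j, ∑ x, ∑ k, M.wordMatrix w i k * M.T x k j
      = ∑ k, M.wordMatrix w i k * ∑ j, ∑ x, M.T x k j := by
        simp only [Finset.mul_sum]
        rw [Finset.sum_congr rfl fun j _ => Finset.sum_comm, Finset.sum_comm]
    _ = _ := by simp only [h, mul_one]

variable [Nonempty S]

theorem outputLaw_eq {t : ℕ} (w : Fin t → X) :
    M.outputLaw t w = ∑ i, M.stationary i * M.probFrom w i := by
  rw [outputLaw, wordProb_eq_sum]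
  refine Finset.sum_congr rfl fun i _ => ?_
  rw [← sum_stepProb]
  simp only [stepProb_eq, probFrom]

theorem outputLaw_nonneg (t : ℕ) (w : Fin t → X) : 0 ≤ M.outputLaw t w := by
  rw [outputLaw_eq]
  exact Finset.sum_nonneg fun i _ => mul_nonneg (M.stationary_spec.1 i) (M.probFrom_nonneg w i)

theorem outputLaw_append {s t : ℕ} (u : Fin s → X) (w : Fin t → X) :
    M.outputLaw (s + t) (Fin.append u w) =
      ∑ j, Matrix.vecMul M.stationary (M.wordMatrix u) j * M.probFrom w j := by
  rw [outputLaw_eq]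
  simp only [probFrom_append, Matrix.vecMul, dotProduct, Finset.mul_sum, Finset.sum_mul]
  rw [Finset.sum_comm]
  exact Finset.sum_congr rfl fun j _ => Finset.sum_congr rfl fun i _ => (mul_assoc _ _ _).symm

theorem sum_vecMul_wordMatrix (s : ℕ) (j : S) :
    ∑ u : Fin s → X, Matrix.vecMul M.stationary (M.wordMatrix u) j = M.stationary j := by
  rw [← Finset.sum_apply, ← Matrix.vecMul_sum, sum_wordMatrix,
    M.stationary_spec.vecMul_pow]

theorem sum_outputLaw_append {t : ℕ} (s : ℕ) (w : Fin t → X) :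
    ∑ u : Fin s → X, M.outputLaw (s + t) (Fin.append u w) = M.outputLaw t w := by
  simp only [outputLaw_append]
  rw [Finset.sum_comm, outputLaw_eq]
  simp only [← Finset.sum_mul, sum_vecMul_wordMatrix]

theorem isStationaryLaw : IsStationaryLaw M.outputLaw where
  nonneg := M.outputLaw_nonneg
  zero w := by
    rw [outputLaw_eq]
    simp [probFrom, wordMatrix_zero, Matrix.one_apply, M.stationary_spec.2.1]
  sum_snoc t w := by
    simp only [outputLaw_eq]
    rw [Finset.sum_comm]
    simp only [← Finset.mul_sum, sum_probFrom_snoc]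
  sum_cons t w := by
    simp only [outputLaw_eq]
    have h : ∀ x i, M.probFrom (Fin.cons (α := fun _ => X) x w) i =
        ∑ j, M.T x i j * M.probFrom w j := fun x i => by
      rw [← sum_mul_probFrom, ← wordMatrix_cons]
      rfl
    simp only [h, Finset.mul_sum]
    rw [Finset.sum_comm, Finset.sum_congr rfl fun i _ => Finset.sum_comm, Finset.sum_comm]
    refine Finset.sum_congr rfl fun j _ => ?_
    have h2 := congrFun M.stationary_spec.2.2 j
    simp only [Matrix.vecMul, dotProduct, trans] at h2
    rw [← h2, Finset.sum_mul]
    refine Finset.sum_congr rfl fun i _ => ?_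
    rw [Finset.mul_sum, Finset.sum_mul]
    exact Finset.sum_congr rfl fun x _ => (mul_assoc _ _ _).symm

/-! ### The entropy rate and the state before the window -/

/-- The entropy rate is at least the conditional entropy of the next symbol given the last `t`
symbols and the state before them: the longer past is conditionally independent of the future
given that state. -/
theorem le_entropyRate (t : ℕ) :
    ∑ w : Fin t → X, ∑ j, M.stationary j *
      rawEntropy (fun x => M.probFrom (Fin.snoc (α := fun _ => X) w x) j) ≤
      entropyRate M.outputLaw := by
  have hlim := (tendsto_add_atTop_iff_nat t).2
    M.isStationaryLaw.tendsto_blockEntropy_and_blockEstimate.2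
  refine ge_of_tendsto hlim (Eventually.of_forall fun m => ?_)
  rw [blockEstimate_succ, sum_fin_append]
  refine Finset.sum_le_sum fun w _ => ?_
  have hstep : ∀ u : Fin m → X,
      ∑ j, Matrix.vecMul M.stationary (M.wordMatrix u) j *
        rawEntropy (fun x => M.probFrom (Fin.snoc (α := fun _ => X) w x) j) ≤
      rawEntropy fun x => M.outputLaw (m + t + 1)
        (Fin.snoc (α := fun _ => X) (Fin.append u w) x) := by
    intro u
    have hnn : ∀ j, 0 ≤ Matrix.vecMul M.stationary (M.wordMatrix u) j := fun j =>
      Finset.sum_nonneg fun i _ => mul_nonneg (M.stationary_spec.1 i) (M.wordMatrix_nonneg u i j)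
    simp only [← rawEntropy_smul]
    refine (rawEntropy_superadditive
      (fun j x => mul_nonneg (hnn j) (M.probFrom_nonneg _ j))).trans (le_of_eq ?_)
    congr 1
    ext x
    rw [← Fin.append_snoc]
    exact (M.outputLaw_append u (Fin.snoc (α := fun _ => X) w x)).symm
  refine le_trans (le_of_eq ?_) (Finset.sum_le_sum fun u _ => hstep u)
  rw [Finset.sum_comm]
  simp only [← Finset.sum_mul, sum_vecMul_wordMatrix]

/-- `h(t+1) - h` is controlled by the dependence of the predictive distribution of the next symbol
on the state before the observed word. -/
theorem blockEstimate_sub_entropyRate_le {t : ℕ} {c d : X → (Fin t → X) → ℝ}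
    (hd : ∀ x w, 0 ≤ d x w)
    (hl : ∀ x w i, c x w * M.probFrom w i ≤ M.probFrom (Fin.snoc (α := fun _ => X) w x) i)
    (hu : ∀ x w i,
      M.probFrom (Fin.snoc (α := fun _ => X) w x) i ≤ (c x w + d x w) * M.probFrom w i) :
    blockEstimate M.outputLaw (t + 1) - entropyRate M.outputLaw ≤
      Fintype.card S / Real.log 2 * ∑ x, ∑ w, M.outputLaw t w * d x w := by
  refine (sub_le_sub_left (M.le_entropyRate t) _).trans ?_
  rw [blockEstimate_succ, ← Finset.sum_sub_distrib, Finset.sum_comm, Finset.mul_sum]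
  refine Finset.sum_le_sum fun w _ => ?_
  have hsum : ∀ i, ∑ x, M.stationary i * M.probFrom (Fin.snoc (α := fun _ => X) w x) i =
      M.stationary i * M.probFrom w i := fun i => by
    rw [← Finset.mul_sum, sum_probFrom_snoc]
  have h := rawEntropy_sum_sub_le
    (p := fun i x => M.stationary i * M.probFrom (Fin.snoc (α := fun _ => X) w x) i)
    (fun i x => mul_nonneg (M.stationary_spec.1 i) (M.probFrom_nonneg _ i))
    (c := fun x => c x w) (d := fun x => d x w) (fun x => hd x w)
    (fun i x => by
      rw [hsum, mul_left_comm]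
      exact mul_le_mul_of_nonneg_left (hl x w i) (M.stationary_spec.1 i))
    (fun i x => by
      rw [hsum, mul_left_comm]
      exact mul_le_mul_of_nonneg_left (hu x w i) (M.stationary_spec.1 i))
  simp only [hsum, rawEntropy_smul, ← outputLaw_eq] at h
  rwa [← Finset.mul_sum]

/-! ### Contraction along flag words -/

/-- The probabilities `ℙ_i(X_t = x | X_0^{t-1} = w)` for the different initial states `i` lie in
an interval whose length, averaged over the word `w`, is at most `D`. -/
def PredictionGap (x : X) (t : ℕ) (D : ℝ) : Prop :=
  ∃ c d : (Fin t → X) → ℝ, (∀ w, 0 ≤ d w) ∧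
    (∀ w i, c w * M.probFrom w i ≤ M.probFrom (Fin.snoc (α := fun _ => X) w x) i) ∧
    (∀ w i, M.probFrom (Fin.snoc (α := fun _ => X) w x) i ≤ (c w + d w) * M.probFrom w i) ∧
    ∑ w, M.outputLaw t w * d w ≤ D

variable {M}

theorem predictionGap_one (x : X) (t : ℕ) : M.PredictionGap x t 1 := by
  refine ⟨fun _ => 0, fun _ => 1, fun _ => zero_le_one, fun w i => ?_, fun w i => ?_, ?_⟩
  · rw [zero_mul]
    exact M.probFrom_nonneg _ i
  · rw [zero_add, one_mul, ← M.sum_probFrom_snoc w i]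
    exact Finset.single_le_sum (f := fun x => M.probFrom (Fin.snoc (α := fun _ => X) w x) i)
      (fun x _ => M.probFrom_nonneg _ i) (Finset.mem_univ x)
  · simp only [mul_one, outputLaw]
    rw [sum_wordProb, M.stationary_spec.2.1]

/-- One step of the contraction. Given the future word `w`, let `k` be the state from which `w` is
most likely. If the preceding block is the flag word `y k`, then every initial state able to
generate it moves to `k` with conditional probability at least `q`, even given `w`. The choice of
`k` also makes the block `y k` occur with conditional probability at least `γ` given `w`. -/
theorem PredictionGap.append {n : ℕ} {y : S → Fin n → X} {q γ : ℝ} (hq0 : 0 ≤ q) (hq1 : q ≤ 1)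
    (hγ0 : 0 ≤ γ) (hγ1 : γ ≤ 1)
    (hq : ∀ k i, q * M.probFrom (y k) i ≤ M.wordMatrix (y k) i k)
    (hy : ∀ k, γ ≤ ∑ i, M.stationary i * M.wordMatrix (y k) i k)
    {x : X} {t : ℕ} {D : ℝ} (h : M.PredictionGap x t D) :
    M.PredictionGap x (n + t) ((1 - γ * q) * D) := by
  classical
  obtain ⟨c, d, hd, hl, hu, hD⟩ := h
  have hmax : ∀ w : Fin t → X, ∃ k, ∀ j, M.probFrom w j ≤ M.probFrom w k := fun w =>
    Finite.exists_max _
  choose k hk using hmax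
  -- `e w` is the prediction made from the state `k w`; if `w` is impossible, any value will do
  have hval : ∀ w : Fin t → X, ∃ e, M.probFrom (Fin.snoc (α := fun _ => X) w x) (k w) =
      e * M.probFrom w (k w) ∧ c w ≤ e ∧ e ≤ c w + d w := by
    intro w
    rcases (M.probFrom_nonneg w (k w)).eq_or_lt with h0 | h0
    · refine ⟨c w, ?_, le_rfl, le_add_of_nonneg_right (hd w)⟩
      have h1 := hl w (k w)
      have h2 := hu w (k w)
      rw [← h0, mul_zero] at h1 h2 ⊢
      exact le_antisymm h2 h1
    · refine ⟨M.probFrom (Fin.snoc (α := fun _ => X) w x) (k w) / M.probFrom w (k w), ?_, ?_, ?_⟩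
      · rw [div_mul_cancel₀ _ h0.ne']
      · rw [le_div_iff₀ h0]
        exact hl w (k w)
      · rw [div_le_iff₀ h0]
        exact hu w (k w)
  choose e he hce hec using hval
  have hsnoc : ∀ (u : Fin n → X) (w : Fin t → X) (i : S),
      M.probFrom (Fin.snoc (α := fun _ => X) (Fin.append u w) x) i =
        ∑ j, M.wordMatrix u i j * M.probFrom (Fin.snoc (α := fun _ => X) w x) j := by
    intro u w i
    rw [← Fin.append_snoc]
    exact M.probFrom_append u _ i
  -- the contraction factor is `1 - q` at a good block and trivial elsewhere
  let θ : (Fin n → X) → (Fin t → X) → ℝ := fun u w => if u = y (k w) then q else 0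
  have hθ0 : ∀ u w, 0 ≤ θ u w := fun u w => by simp only [θ]; split_ifs <;> linarith
  have hθ1 : ∀ u w, θ u w ≤ 1 := fun u w => by simp only [θ]; split_ifs <;> linarith
  have hθk : ∀ u w i, θ u w * ∑ j, M.wordMatrix u i j * M.probFrom w j ≤
      M.wordMatrix u i (k w) * M.probFrom w (k w) := by
    intro u w i
    by_cases h : u = y (k w)
    · simp only [θ, if_pos h]
      calc q * ∑ j, M.wordMatrix u i j * M.probFrom w j
          ≤ q * ∑ j, M.wordMatrix u i j * M.probFrom w (k w) := by
            refine mul_le_mul_of_nonneg_left (Finset.sum_le_sum fun j _ => ?_) hq0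
            exact mul_le_mul_of_nonneg_left (hk w j) (M.wordMatrix_nonneg u i j)
        _ = q * M.probFrom u i * M.probFrom w (k w) := by
            rw [← Finset.sum_mul, mul_assoc]
            rfl
        _ ≤ _ := by
            refine mul_le_mul_of_nonneg_right ?_ (M.probFrom_nonneg w _)
            rw [h]
            exact hq _ i
    · simp only [θ, if_neg h, zero_mul]
      exact mul_nonneg (M.wordMatrix_nonneg u i _) (M.probFrom_nonneg w _)
  have hbounds := fun u w i => weighted_average_bounds (fun j => M.wordMatrix_nonneg u i j)
    (hl w) (hu w) (he w) (hθk u w i) (hce w) (hec w)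
  let E := (Fin.appendEquiv (α := X) n t).symm
  have hE : ∀ v, Fin.append (E v).1 (E v).2 = v := fun v =>
    (Fin.appendEquiv (α := X) n t).apply_symm_apply v
  have hE' : ∀ u w, E (Fin.append u w) = (u, w) := fun u w =>
    (Fin.appendEquiv (α := X) n t).symm_apply_apply (u, w)
  refine ⟨fun v => θ (E v).1 (E v).2 * e (E v).2 + (1 - θ (E v).1 (E v).2) * c (E v).2,
    fun v => (1 - θ (E v).1 (E v).2) * d (E v).2, fun v => ?_, fun v i => ?_, fun v i => ?_, ?_⟩
  · exact mul_nonneg (sub_nonneg.2 (hθ1 _ _)) (hd _)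
  · have h := (hbounds (E v).1 (E v).2 i).1
    rwa [← hsnoc, ← probFrom_append, hE] at h
  · have h := (hbounds (E v).1 (E v).2 i).2
    rwa [← hsnoc, ← probFrom_append, hE] at h
  · rw [sum_fin_append]
    simp only [hE']
    have hgood : ∀ w : Fin t → X, γ * M.outputLaw t w ≤
        M.outputLaw (n + t) (Fin.append (y (k w)) w) := by
      intro w
      have hPw : M.outputLaw t w ≤ M.probFrom w (k w) := by
        rw [outputLaw_eq, ← one_mul (M.probFrom w (k w)), ← M.stationary_spec.2.1, Finset.sum_mul]
        exact Finset.sum_le_sum fun j _ =>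
          mul_le_mul_of_nonneg_left (hk w j) (M.stationary_spec.1 j)
      rw [outputLaw_append]
      calc γ * M.outputLaw t w ≤ γ * M.probFrom w (k w) := mul_le_mul_of_nonneg_left hPw hγ0
        _ ≤ Matrix.vecMul M.stationary (M.wordMatrix (y (k w))) (k w) * M.probFrom w (k w) :=
            mul_le_mul_of_nonneg_right (hy (k w)) (M.probFrom_nonneg w _)
        _ ≤ _ := by
            refine Finset.single_le_sum (f := fun j =>
              Matrix.vecMul M.stationary (M.wordMatrix (y (k w))) j * M.probFrom w j)
              (fun j _ => mul_nonneg (Finset.sum_nonneg fun i _ => ?_) (M.probFrom_nonneg w j))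
              (Finset.mem_univ _)
            exact mul_nonneg (M.stationary_spec.1 i) (M.wordMatrix_nonneg _ i j)
    calc ∑ w : Fin t → X, ∑ u : Fin n → X,
          M.outputLaw (n + t) (Fin.append u w) * ((1 - θ u w) * d w)
        = ∑ w : Fin t → X, (M.outputLaw t w -
            q * M.outputLaw (n + t) (Fin.append (y (k w)) w)) * d w := by
          refine Finset.sum_congr rfl fun w _ => ?_
          rw [← M.sum_outputLaw_append n w, sub_mul, Finset.sum_mul]
          simp only [← mul_assoc, ← Finset.sum_mul, mul_sub, mul_one, Finset.sum_sub_distrib,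
            sub_mul, θ, mul_ite, mul_zero, Finset.sum_ite_eq', Finset.mem_univ, if_true]
          ring
      _ ≤ ∑ w : Fin t → X, (1 - γ * q) * (M.outputLaw t w * d w) := by
          refine Finset.sum_le_sum fun w _ => ?_
          rw [← mul_assoc]
          refine mul_le_mul_of_nonneg_right ?_ (hd w)
          have := mul_le_mul_of_nonneg_left (hgood w) hq0
          linarith
      _ ≤ (1 - γ * q) * D := by
          rw [← Finset.mul_sum]
          refine mul_le_mul_of_nonneg_left hD ?_
          have := mul_le_one₀ hγ1 hq0 hq1
          linarith

/-- Iterated contraction: flag words of length `n` give a geometric bound for `h(t) - h`. -/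
theorem convergenceRate_le_of_flagWords {n : ℕ} (hn : 1 ≤ n) {y : S → Fin n → X} {q γ α : ℝ}
    (hq0 : 0 ≤ q) (hq1 : q ≤ 1) (hγ0 : 0 ≤ γ) (hγ1 : γ ≤ 1)
    (hq : ∀ k i, q * M.probFrom (y k) i ≤ M.wordMatrix (y k) i k)
    (hy : ∀ k, γ ≤ ∑ i, M.stationary i * M.wordMatrix (y k) i k)
    (hα0 : 0 < α) (hα1 : α ≤ 1) (hα : 1 - γ * q ≤ α) :
    convergenceRate M.outputLaw ≤ ((α ^ (1 / (n : ℝ)) : ℝ) : EReal) := by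
  have hρ0 : 0 ≤ 1 - γ * q := by
    have := mul_le_one₀ hγ1 hq0 hq1
    linarith
  have hgap : ∀ (x : X) (r m : ℕ), M.PredictionGap x (n * m + r) ((1 - γ * q) ^ m) := by
    intro x r m
    induction m with
    | zero => simpa using predictionGap_one x _
    | succ m ih =>
      rw [show n * (m + 1) + r = n + (n * m + r) by ring, pow_succ']
      exact ih.append hq0 hq1 hγ0 hγ1 hq hy
  have hlog : 0 < Real.log 2 := Real.log_pos one_lt_two
  set β := α ^ (1 / (n : ℝ)) with hβ
  have hβ0 : 0 < β := Real.rpow_pos_of_pos hα0 _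
  have hβ1 : β ≤ 1 := Real.rpow_le_one hα0.le hα1 (by positivity)
  have hβn : β ^ n = α := by
    rw [hβ, one_div, Real.rpow_inv_natCast_pow hα0.le (by omega)]
  refine M.isStationaryLaw.convergenceRate_le
    (C := Fintype.card S / Real.log 2 * Fintype.card X * α⁻¹) hβ0 fun t => ?_
  have hgap' : ∀ x, M.PredictionGap x t ((1 - γ * q) ^ (t / n)) := fun x => by
    have := hgap x (t % n) (t / n)
    rwa [Nat.div_add_mod] at this
  choose c d hd hl hu hD using hgap'
  -- the factor `α⁻¹` makes up for rounding `t / n` down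
  have hpow : (1 - γ * q) ^ (t / n) ≤ α⁻¹ * β ^ (t + 1) := by
    refine (pow_le_pow_left₀ hρ0 hα _).trans ?_
    rw [le_inv_mul_iff₀ hα0, ← pow_succ', ← hβn, ← pow_mul]
    refine pow_le_pow_of_le_one hβ0.le hβ1 ?_
    exact Nat.succ_le_of_lt (Nat.lt_mul_div_succ t (by omega))
  calc _ ≤ Fintype.card S / Real.log 2 * ∑ x, ∑ w, M.outputLaw t w * d x w :=
        M.blockEstimate_sub_entropyRate_le hd hl hu
    _ ≤ Fintype.card S / Real.log 2 * ∑ _x : X, α⁻¹ * β ^ (t + 1) := by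
        refine mul_le_mul_of_nonneg_left (Finset.sum_le_sum fun x _ => (hD x).trans hpow) ?_
        positivity
    _ = _ := by
        rw [Finset.sum_const, nsmul_eq_mul, Finset.card_univ]
        ring

end EdgeHMM

/-! ### Irreducible matrices and their powers -/

section Irreducible

variable {S : Type*} [Fintype S] [DecidableEq S] {A : Matrix S S ℝ}

theorem IsStationaryDist.eq [Nonempty S] (hA : A.IsIrreducible) {p q : S → ℝ}
    (hp : IsStationaryDist A p) (hq : IsStationaryDist A q) : p = q := by
  have hq0 := hq.pos hA
  obtain ⟨k, hk⟩ := Finite.exists_min fun i => p i / q i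
  set c := p k / q k with hc
  -- the stationary vector `p - c q` is nonnegative and vanishes at `k`
  have hr0 : ∀ i, 0 ≤ p i - c * q i := fun i => by
    have := (le_div_iff₀ (hq0 i)).1 (hk i)
    linarith
  have hrk : p k - c * q k = 0 := by rw [hc, div_mul_cancel₀ _ (hq0 k).ne', sub_self]
  have hrA : Matrix.vecMul (p - c • q) A = p - c • q := by
    rw [Matrix.sub_vecMul, Matrix.smul_vecMul, hp.2.2, hq.2.2]
  have hsum : ∑ i, (p i - c * q i) = 1 - c := by
    rw [Finset.sum_sub_distrib, ← Finset.mul_sum, hp.2.1, hq.2.1, mul_one]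
  have hc1 : 0 ≤ 1 - c := hsum ▸ Finset.sum_nonneg fun i _ => hr0 i
  rcases hc1.eq_or_lt with h | h
  · have hz := (Finset.sum_eq_zero_iff_of_nonneg fun i _ => hr0 i).1 (hsum.trans h.symm)
    ext i
    have := hz i (Finset.mem_univ i)
    rw [show c = 1 by linarith] at this
    linarith
  · have hst : IsStationaryDist A ((1 - c)⁻¹ • (p - c • q)) := by
      refine ⟨fun i => mul_nonneg (inv_nonneg.2 hc1) (hr0 i), ?_, ?_⟩
      · simp only [Pi.smul_apply, Pi.sub_apply, smul_eq_mul, ← Finset.mul_sum, hsum]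
        exact inv_mul_cancel₀ h.ne'
      · rw [Matrix.smul_vecMul, hrA]
    have := hst.pos hA k
    simp [hrk] at this

omit [DecidableEq S] in
theorem Matrix.mul_apply_pos {A B : Matrix S S ℝ} (hA : ∀ i j, 0 ≤ A i j) (hB : ∀ i j, 0 ≤ B i j)
    {i j k : S} (h1 : 0 < A i j) (h2 : 0 < B j k) : 0 < (A * B) i k :=
  Finset.sum_pos' (fun l _ => mul_nonneg (hA i l) (hB l k)) ⟨j, Finset.mem_univ _, mul_pos h1 h2⟩

theorem Matrix.pow_add_apply_pos (hA : ∀ i j, 0 ≤ A i j) {m n : ℕ} {i j k : S}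
    (h1 : 0 < (A ^ m) i j) (h2 : 0 < (A ^ n) j k) : 0 < (A ^ (m + n)) i k := by
  rw [pow_add]
  exact Matrix.mul_apply_pos (Matrix.pow_apply_nonneg hA m) (Matrix.pow_apply_nonneg hA n) h1 h2

theorem Matrix.pow_mul_apply_self_pos (hA : ∀ i j, 0 ≤ A i j) {m : ℕ} {i : S}
    (h : 0 < (A ^ m) i i) (n : ℕ) : 0 < (A ^ (n * m)) i i := by
  induction n with
  | zero => simp
  | succ n ih =>
    rw [Nat.succ_mul]
    exact Matrix.pow_add_apply_pos hA ih h

variable [Nonempty S]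

theorem Matrix.IsIrreducible.matrixPeriod_spec (hA : A.IsIrreducible) :
    0 < matrixPeriod A ∧
      ∀ d : ℕ, (∀ (k : ℕ) (i : S), 0 < k → 0 < (A ^ k) i i → d ∣ k) → d ∣ matrixPeriod A := by
  obtain ⟨i⟩ := ‹Nonempty S›
  obtain ⟨k, hk, hpos⟩ := (Matrix.isIrreducible_iff_exists_pow_pos hA.nonneg).1 hA i i
  set D := {d : ℕ | ∀ (k : ℕ) (i : S), 0 < k → 0 < (A ^ k) i i → d ∣ k} with hD
  have hbdd : BddAbove D := ⟨k, fun d hd => Nat.le_of_dvd hk (hd k i hk hpos)⟩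
  have h1 : 1 ∈ D := fun k _ _ _ => one_dvd k
  have hmem : matrixPeriod A ∈ D := Nat.sSup_mem ⟨1, h1⟩ hbdd
  have hpos' : 0 < matrixPeriod A := le_csSup hbdd h1
  refine ⟨hpos', fun d hd => ?_⟩
  have hlcm : Nat.lcm d (matrixPeriod A) ∈ D := fun k i hk h =>
    Nat.lcm_dvd (hd k i hk h) (hmem k i hk h)
  have hle : Nat.lcm d (matrixPeriod A) ≤ matrixPeriod A := le_csSup hbdd hlcm
  have h0 : 0 < Nat.lcm d (matrixPeriod A) := Nat.pos_of_dvd_of_pos (hlcm k i hk hpos) hk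
  rw [← le_antisymm hle (Nat.le_of_dvd h0 (Nat.dvd_lcm_right _ _))]
  exact Nat.dvd_lcm_left _ _

/-- The lengths of the closed walks at a state represent a subgroup of `ZMod n`, which is
everything if `n` is coprime to the period; so a walk between two states can be prolonged to a
walk whose length is a multiple of `n`. -/
theorem Matrix.IsIrreducible.pow (hA : A.IsIrreducible) {n : ℕ} (hn : 1 ≤ n)
    (hcop : n.Coprime (matrixPeriod A)) : (A ^ n).IsIrreducible := by
  have hirr := (Matrix.isIrreducible_iff_exists_pow_pos hA.nonneg).1 hA
  have hA0 := hA.nonneg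
  rw [Matrix.isIrreducible_iff_exists_pow_pos (Matrix.pow_apply_nonneg hA0 n)]
  intro i j
  obtain ⟨m, hm, hmpos⟩ := hirr i j
  let H : AddSubgroup (ZMod n) :=
    { carrier := {z | ∃ k : ℕ, 0 < (A ^ k) j j ∧ (k : ZMod n) = z}
      zero_mem' := ⟨0, by simp, by simp⟩
      add_mem' := by
        rintro _ _ ⟨k, hk, rfl⟩ ⟨l, hl, rfl⟩
        exact ⟨k + l, Matrix.pow_add_apply_pos hA0 hk hl, by simp⟩
      neg_mem' := by
        rintro _ ⟨k, hk, rfl⟩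
        refine ⟨(n - 1) * k, Matrix.pow_mul_apply_self_pos hA0 hk _, ?_⟩
        rw [Nat.cast_mul, Nat.cast_sub hn]
        simp }
  obtain ⟨a, ha⟩ := Int.subgroup_cyclic (H.comap (Int.castAddHom (ZMod n)))
  have hdvd : ∀ z : ℤ, (z : ZMod n) ∈ H ↔ a ∣ z := fun z => by
    rw [← Int.mem_zmultiples_iff, AddSubgroup.zmultiples_eq_closure, ← ha]
    rfl
  have han : a.natAbs ∣ n := by
    rw [← Int.natCast_dvd_natCast, Int.natAbs_dvd, ← hdvd]
    simp
  have haj : ∀ k : ℕ, 0 < (A ^ k) j j → a.natAbs ∣ k := fun k hk => by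
    rw [← Int.natCast_dvd_natCast, Int.natAbs_dvd, ← hdvd]
    exact ⟨k, hk, by simp⟩
  have hper : a.natAbs ∣ matrixPeriod A := by
    refine hA.matrixPeriod_spec.2 _ fun k l _ hk => ?_
    obtain ⟨b, -, hb⟩ := hirr j l
    obtain ⟨c, -, hc⟩ := hirr l j
    have h1 := haj _ (Matrix.pow_add_apply_pos hA0 hb hc)
    have h2 := haj _ (Matrix.pow_add_apply_pos hA0 (Matrix.pow_add_apply_pos hA0 hb hk) hc)
    rw [show b + k + c = (b + c) + k by ring] at h2
    exact (Nat.dvd_add_right h1).1 h2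
  have ha1 : a.natAbs = 1 := Nat.dvd_one.1 (hcop ▸ Nat.dvd_gcd han hper)
  have hall : ((-(m : ℤ) : ℤ) : ZMod n) ∈ H :=
    (hdvd _).2 (Int.natAbs_dvd.1 (by rw [ha1]; exact one_dvd _))
  obtain ⟨k, hk, hkm⟩ := hall
  have hmk : n ∣ m + k := by
    rw [← ZMod.natCast_eq_zero_iff, Nat.cast_add, hkm]
    simp
  obtain ⟨l, hl⟩ := hmk
  refine ⟨l, Nat.pos_of_ne_zero fun h0 => ?_, ?_⟩
  · rw [h0] at hl
    omega
  · rw [← pow_mul, ← hl]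
    exact Matrix.pow_add_apply_pos hA0 hmpos hk

end Irreducible

/-! ### The rate attached to a choice of flag symbols -/

/-- The rate `1 - p q` of the contraction is at least as good as the rate coming from counting
good blocks: with `c = 1 - q²`, the second entry of the maximum dominates `1 - p (1 - c)` for
`c ≥ exp (-p)`, by concavity of `c ^ (p / 2)`, and the first one does so for `c ≤ exp (-p)`. -/
theorem one_sub_mul_le_max {p q : ℝ} (hp0 : 0 ≤ p) (hp1 : p ≤ 1) (hq0 : 0 ≤ q) (hq1 : q ≤ 1) :
    1 - p * q ≤ max (Real.exp (-(p ^ 2 / 2))) ((1 - q ^ 2) ^ (p / 2)) := by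
  set e := Real.exp (-p) with he
  have he0 : 0 < e := Real.exp_pos _
  have hep : e ≤ 1 - p / 2 := by
    have h1 : e * (1 + p) ≤ 1 := by
      have h2 := mul_le_mul_of_nonneg_left (Real.add_one_le_exp p) he0.le
      rw [he, ← Real.exp_add, neg_add_cancel, Real.exp_zero] at h2
      linarith
    nlinarith
  have hE : 1 - p * (1 - e) ≤ Real.exp (-(p ^ 2 / 2)) := by
    have := Real.add_one_le_exp (-(p ^ 2 / 2))
    nlinarith
  have hqq : 1 - p * q ≤ 1 - p * q ^ 2 := by
    have : q ^ 2 ≤ q := by nlinarith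
    nlinarith
  refine hqq.trans ?_
  rcases le_total (1 - q ^ 2) e with hc | hc
  · refine le_max_of_le_left (le_trans ?_ hE)
    nlinarith
  · refine le_max_of_le_right ?_
    rcases hp0.eq_or_lt with rfl | hp
    · simp
    have he1 : 0 < 1 - e := by linarith
    set l := q ^ 2 / (1 - e) with hl
    have hle : l * (1 - e) = q ^ 2 := div_mul_cancel₀ _ he1.ne'
    have hl0 : 0 ≤ l := by positivity
    have hl1 : l ≤ 1 := (div_le_one he1).2 (by linarith)
    have hconc := (Real.concaveOn_rpow (p := p / 2) (by linarith) (by linarith)).2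
      (x := e) (y := 1) he0.le (zero_le_one (α := ℝ)) hl0 (sub_nonneg.2 hl1) (by ring)
    simp only [smul_eq_mul, Real.one_rpow, mul_one] at hconc
    rw [show l * e + (1 - l) = 1 - q ^ 2 by linarith, he, ← Real.exp_mul,
      show -p * (p / 2) = -(p ^ 2 / 2) by ring] at hconc
    refine le_trans ?_ hconc
    have h3 := mul_le_mul_of_nonneg_left hE hl0
    have h4 : p * (l * (1 - e)) = p * q ^ 2 := by rw [hle]
    linarith

theorem exists_pos_of_sum_pos {ι : Type*} [Fintype ι] {f : ι → ℝ} (h : 0 < ∑ i, f i) :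
    ∃ i, 0 < f i := by
  by_contra! hf
  exact h.not_ge (Finset.sum_nonpos fun i _ => hf i)

theorem pos_and_pos_of_mul_pos {a b : ℝ} (ha : 0 ≤ a) (hb : 0 ≤ b) (h : 0 < a * b) :
    0 < a ∧ 0 < b :=
  ⟨ha.lt_of_ne' (left_ne_zero_of_mul h.ne'), hb.lt_of_ne' (right_ne_zero_of_mul h.ne')⟩

theorem ciInf_pos_of_finite {ι : Type*} [Finite ι] [Nonempty ι] {f : ι → ℝ} (h : ∀ i, 0 < f i) :
    0 < ⨅ i, f i := by
  obtain ⟨i, hi⟩ := exists_eq_ciInf_of_finite (f := f)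
  rw [← hi]
  exact h i

theorem ciInf_le_of_finite {ι : Type*} [Finite ι] (f : ι → ℝ) (i : ι) : ⨅ i, f i ≤ f i :=
  ciInf_le (Set.finite_range f).bddBelow i

namespace EdgeHMM

variable {S X : Type*} [Fintype S] [Fintype X] [DecidableEq S]

theorem mem_delta_single (M : EdgeHMM S X) {x : X} {i j : S} :
    j ∈ M.delta i ![x] ↔ 0 < M.T x i j := by
  have h : M.wordMatrix ![x] = M.T x := by
    simp [wordMatrix]
  simp [delta, stepProb_eq, h]

theorem isFlagSymbol_iff (M : EdgeHMM S X) {x : X} {k : S} :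
    M.IsFlagSymbol x k ↔ ∀ i, 0 < ∑ j, M.T x i j → 0 < M.T x i k := by
  refine forall_congr' fun i => imp_congr ?_ M.mem_delta_single
  constructor
  · rintro ⟨j, hj⟩
    exact Finset.sum_pos' (fun j _ => M.nonneg x i j)
      ⟨j, Finset.mem_univ j, M.mem_delta_single.1 hj⟩
  · intro h
    obtain ⟨j, hj⟩ := exists_pos_of_sum_pos h
    exact ⟨j, M.mem_delta_single.2 hj⟩

variable [Nonempty S] {M : EdgeHMM S X} {y : S → X}

theorem sum_stationary_mul_trans (j : S) :
    ∑ i, M.stationary i * M.trans i j = M.stationary j :=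
  congrFun M.stationary_spec.2.2 j

theorem pStar_mul_le (hM : M.IsIrreducible) (j : S) :
    M.pStar y * M.stationary j ≤ ∑ i, M.stationary i * M.T (y j) i j := by
  have h := ciInf_le_of_finite (fun j => (∑ i, M.stationary i * M.T (y j) i j) /
    (∑ i, M.stationary i * M.trans i j)) j
  simp only [sum_stationary_mul_trans] at h
  rw [← le_div_iff₀ (M.stationary_spec.pos hM j)]
  simpa only [pStar, sum_stationary_mul_trans] using h

theorem pStar_pos (hM : M.IsIrreducible) (hy : ∀ k, M.IsFlagSymbol (y k) k) : 0 < M.pStar y := by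
  refine ciInf_pos_of_finite fun j => ?_
  rw [sum_stationary_mul_trans]
  obtain ⟨i, hi⟩ := M.symbol_used (y j)
  have hpos := M.stationary_spec.pos hM
  refine div_pos (Finset.sum_pos' (fun i _ => mul_nonneg (hpos i).le (M.nonneg _ _ _))
    ⟨i, Finset.mem_univ i, mul_pos (hpos i) (M.isFlagSymbol_iff.1 (hy j) i hi)⟩) (hpos j)

theorem pStar_le_one (hM : M.IsIrreducible) : M.pStar y ≤ 1 := by
  obtain ⟨j⟩ := ‹Nonempty S›
  have hpos := M.stationary_spec.pos hM
  refine (ciInf_le_of_finite _ j).trans (div_le_one_of_le₀ ?_ ?_)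
  · refine Finset.sum_le_sum fun i _ => mul_le_mul_of_nonneg_left ?_ (hpos i).le
    exact Finset.single_le_sum (f := fun x => M.T x i j) (fun x _ => M.nonneg x i j)
      (Finset.mem_univ _)
  · exact Finset.sum_nonneg fun i _ => mul_nonneg (hpos i).le (M.trans_nonneg i j)

omit [DecidableEq S] [Nonempty S] in
theorem qStar_mul_le (j i : S) : M.qStar y * ∑ k, M.T (y j) i k ≤ M.T (y j) i j := by
  rcases (Finset.sum_nonneg fun k _ => M.nonneg (y j) i k).eq_or_lt with h | h
  · rw [← h, mul_zero]
    exact M.nonneg _ _ _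
  · rw [← le_div_iff₀ h]
    exact (ciInf_le_of_finite (fun j => ⨅ i : {i : S // 0 < ∑ k, M.T (y j) i k},
      M.T (y j) i j / ∑ k, M.T (y j) i k) j).trans
      (ciInf_le_of_finite (fun i : {i : S // 0 < ∑ k, M.T (y j) i k} =>
        M.T (y j) i j / ∑ k, M.T (y j) i k) ⟨i, h⟩)

theorem qStar_pos (hy : ∀ k, M.IsFlagSymbol (y k) k) : 0 < M.qStar y := by
  refine ciInf_pos_of_finite fun j => ?_
  have : Nonempty {i : S // 0 < ∑ k, M.T (y j) i k} := nonempty_subtype.2 (M.symbol_used (y j))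
  exact ciInf_pos_of_finite fun i => div_pos (M.isFlagSymbol_iff.1 (hy j) i i.2) i.2

omit [DecidableEq S] in
theorem qStar_le_one : M.qStar y ≤ 1 := by
  obtain ⟨j⟩ := ‹Nonempty S›
  obtain ⟨i, hi⟩ := M.symbol_used (y j)
  refine le_of_mul_le_mul_right ((qStar_mul_le j i).trans ?_) hi
  rw [one_mul]
  exact Finset.single_le_sum (fun k _ => M.nonneg (y j) i k) (Finset.mem_univ j)

theorem rStar_mul_le (hM : M.IsIrreducible) (i j : S) :
    M.rStar * M.stationary j ≤ M.stationary i := by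
  rw [← le_div_iff₀ (M.stationary_spec.pos hM j)]
  exact (ciInf_le_of_finite (fun i => ⨅ j, M.stationary i / M.stationary j) i).trans
    (ciInf_le_of_finite (fun j => M.stationary i / M.stationary j) j)

theorem rStar_pos (hM : M.IsIrreducible) : 0 < M.rStar :=
  have hpos := M.stationary_spec.pos hM
  ciInf_pos_of_finite fun i => ciInf_pos_of_finite fun j => div_pos (hpos i) (hpos j)

theorem rStar_le_one (hM : M.IsIrreducible) : M.rStar ≤ 1 := by
  obtain ⟨j⟩ := ‹Nonempty S›
  refine le_of_mul_le_mul_right ((rStar_mul_le hM j j).trans ?_) (M.stationary_spec.pos hM j)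
  rw [one_mul]

theorem rStar_div_card_le (hM : M.IsIrreducible) (i : S) :
    M.rStar / Fintype.card S ≤ M.stationary i := by
  have hS : (0 : ℝ) < Fintype.card S := Nat.cast_pos.2 Fintype.card_pos
  rw [div_le_iff₀ hS]
  calc M.rStar = ∑ j, M.rStar * M.stationary j := by
        rw [← Finset.mul_sum, M.stationary_spec.2.1, mul_one]
    _ ≤ ∑ _j : S, M.stationary i := Finset.sum_le_sum fun j _ => rStar_mul_le hM i j
    _ = M.stationary i * Fintype.card S := by
        rw [Finset.sum_const, nsmul_eq_mul, Finset.card_univ, mul_comm]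

theorem flagRate_spec (hM : M.IsIrreducible) (hy : ∀ k, M.IsFlagSymbol (y k) k) :
    0 < M.flagRate y ∧ M.flagRate y < 1 ∧
      1 - M.pStar y * M.rStar / Fintype.card S * M.qStar y ≤ M.flagRate y := by
  have hp0 := pStar_pos hM hy
  have hp1 := pStar_le_one (y := y) hM
  have hq0 := qStar_pos hy
  have hq1 := qStar_le_one (M := M) (y := y)
  have hr0 := rStar_pos hM
  have hr1 := rStar_le_one hM
  have hS : (1 : ℝ) ≤ Fintype.card S := Nat.one_le_cast.2 Fintype.card_pos
  refine ⟨lt_max_of_lt_left (Real.exp_pos _), max_lt ?_ ?_, ?_⟩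
  · refine (Real.exp_lt_one_iff).2 (neg_neg_iff_pos.2 ?_)
    positivity
  · refine Real.rpow_lt_one ?_ ?_ ?_
    · nlinarith
    · nlinarith
    · unfold eta
      positivity
  · have h := one_sub_mul_le_max (p := M.pStar y * M.rStar / Fintype.card S) (by positivity)
      (div_le_one_of_le₀ ((mul_le_one₀ hp1 hr0.le hr1).trans hS) (by positivity)) hq0.le hq1
    rw [flagRate, alpha₁, alpha₂, eta]
    rwa [show (M.pStar y * M.rStar / Fintype.card S) ^ 2 / 2 =
        M.pStar y ^ 2 * M.rStar ^ 2 / (2 * (Fintype.card S : ℝ) ^ 2) by ring,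
      show M.pStar y * M.rStar / Fintype.card S / 2 =
        M.pStar y * M.rStar / (2 * (Fintype.card S : ℝ)) by ring] at h

/-! ### Block models and flag words -/

theorem blockModel_T (hM : M.IsIrreducible) {n : ℕ} (w : M.BlockAlphabet n) (i j : S) :
    (M.blockModel hM n).T w i j = M.wordMatrix w.1 i j :=
  M.stepProb_eq w.1 i j

theorem blockModel_trans (hM : M.IsIrreducible) (n : ℕ) :
    (M.blockModel hM n).trans = M.trans ^ n := by
  ext i j
  rw [← sum_wordMatrix, Matrix.sum_apply]
  refine Finset.sum_of_injOn (fun w : M.BlockAlphabet n => w.1)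
    (fun a _ b _ h => Subtype.val_injective h) (fun _ _ => by simp) ?_
    (fun w _ => blockModel_T hM w i j)
  intro w _ hw
  have hle : M.wordMatrix w i j ≤ M.probFrom w i :=
    Finset.single_le_sum (fun j _ => M.wordMatrix_nonneg w i j) (Finset.mem_univ j)
  have h0 : M.probFrom w i = 0 := by
    have h := M.wordProb_single_eq_zero hM (w := w)
      (fun hpos => hw ⟨⟨w, hpos⟩, Finset.mem_coe.2 (Finset.mem_univ _), rfl⟩) i
    rw [← sum_stepProb] at h
    simpa only [stepProb_eq, probFrom] using h
  exact le_antisymm (h0 ▸ hle) (M.wordMatrix_nonneg w i j)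

theorem blockModel_isIrreducible (hM : M.IsIrreducible) {n : ℕ} (hn : 1 ≤ n)
    (hcop : n.Coprime M.period) : (M.blockModel hM n).IsIrreducible := by
  unfold IsIrreducible
  rw [blockModel_trans]
  exact Matrix.IsIrreducible.pow hM hn hcop

theorem blockModel_stationary (hM : M.IsIrreducible) {n : ℕ} (hn : 1 ≤ n)
    (hcop : n.Coprime M.period) : (M.blockModel hM n).stationary = M.stationary := by
  refine IsStationaryDist.eq (blockModel_isIrreducible hM hn hcop)
    (M.blockModel hM n).stationary_spec ⟨M.stationary_spec.1, M.stationary_spec.2.1, ?_⟩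
  rw [blockModel_trans, M.stationary_spec.vecMul_pow]

theorem convergenceRate_le_flagRate (hM : M.IsIrreducible) {n : ℕ} (hn : 1 ≤ n)
    (hcop : n.Coprime M.period) {y : S → M.BlockAlphabet n}
    (hy : ∀ k, (M.blockModel hM n).IsFlagSymbol (y k) k) :
    0 < (M.blockModel hM n).flagRate y ∧ (M.blockModel hM n).flagRate y < 1 ∧
      convergenceRate M.outputLaw ≤
        (((M.blockModel hM n).flagRate y ^ (1 / (n : ℝ)) : ℝ) : EReal) := by
  have hN := blockModel_isIrreducible hM hn hcop
  have hstat := blockModel_stationary hM hn hcop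
  obtain ⟨hα0, hα1, hα⟩ := flagRate_spec hN hy
  refine ⟨hα0, hα1, ?_⟩
  have hp0 := pStar_pos hN hy
  have hp1 := pStar_le_one (y := y) hN
  have hr0 := rStar_pos hN
  have hr1 := rStar_le_one hN
  have hS : (1 : ℝ) ≤ Fintype.card S := Nat.one_le_cast.2 Fintype.card_pos
  refine convergenceRate_le_of_flagWords hn (y := fun k => (y k).1) (qStar_pos hy).le qStar_le_one
    (γ := (M.blockModel hM n).pStar y * (M.blockModel hM n).rStar / Fintype.card S) (by positivity)
    (div_le_one_of_le₀ ((mul_le_one₀ hp1 hr0.le hr1).trans hS) (by positivity))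
    (fun k i => ?_) (fun k => ?_) hα0 hα1.le hα
  · have h := qStar_mul_le (M := M.blockModel hM n) (y := y) k i
    simpa only [blockModel_T, probFrom] using h
  · have h := pStar_mul_le (y := y) hN k
    simp only [blockModel_T, hstat] at h
    refine le_trans ?_ h
    rw [mul_div_assoc, ← hstat]
    exact mul_le_mul_of_nonneg_left (rStar_div_card_le hN k) hp0.le

variable (M) in
/-- A word of positive probability after which every state able to generate it may have moved
to `k`. -/
def IsFlagWord {t : ℕ} (w : Fin t → X) (k : S) : Prop :=
  (∃ i, 0 < M.wordMatrix w i k) ∧ ∀ i j, 0 < M.wordMatrix w i j → 0 < M.wordMatrix w i k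

omit [Nonempty S] in
theorem wordMatrix_append_pos {s t : ℕ} {u : Fin s → X} {w : Fin t → X} {i j k : S}
    (h1 : 0 < M.wordMatrix u i j) (h2 : 0 < M.wordMatrix w j k) :
    0 < M.wordMatrix (Fin.append u w) i k := by
  rw [wordMatrix_append]
  exact Matrix.mul_apply_pos (M.wordMatrix_nonneg u) (M.wordMatrix_nonneg w) h1 h2

omit [Nonempty S] in
theorem exists_of_wordMatrix_append_pos {s t : ℕ} {u : Fin s → X} {w : Fin t → X} {i k : S}
    (h : 0 < M.wordMatrix (Fin.append u w) i k) :
    ∃ j, 0 < M.wordMatrix u i j ∧ 0 < M.wordMatrix w j k := by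
  rw [wordMatrix_append, Matrix.mul_apply] at h
  obtain ⟨j, hj⟩ := exists_pos_of_sum_pos h
  exact ⟨j, pos_and_pos_of_mul_pos (M.wordMatrix_nonneg _ _ _) (M.wordMatrix_nonneg _ _ _) hj⟩

omit [Nonempty S] in
theorem exists_wordMatrix_pos {t : ℕ} {i j : S} (h : 0 < (M.trans ^ t) i j) :
    ∃ w : Fin t → X, 0 < M.wordMatrix w i j := by
  rw [← sum_wordMatrix, Matrix.sum_apply] at h
  exact exists_pos_of_sum_pos h

omit [Nonempty S] in
theorem IsPathMergeable.exists_wordMatrix_pos (h : M.IsPathMergeable) (i j : S) :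
    ∃ (t : ℕ) (w : Fin t → X) (k : S), 0 < M.wordMatrix w i k ∧ 0 < M.wordMatrix w j k := by
  rcases eq_or_ne i j with rfl | hij
  · exact ⟨0, Fin.elim0, i, by simp [wordMatrix_zero]⟩
  · obtain ⟨t, w, k, h1, h2⟩ := h i j hij
    simp only [delta, Set.mem_ofPred_eq, stepProb_eq] at h1 h2
    exact ⟨t, w, k, h1, h2⟩

/-- The initial states are merged one after the other: a word prolonging the current one merges
the common target of the states treated so far with a state reached from the new one. -/
theorem IsPathMergeable.exists_isFlagWord (h : M.IsPathMergeable) :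
    ∃ (t : ℕ) (w : Fin t → X) (k : S), M.IsFlagWord w k := by
  have key : ∀ F : Finset S, ∃ (t : ℕ) (w : Fin t → X) (k : S), (∃ i, 0 < M.wordMatrix w i k) ∧
      ∀ i ∈ F, ∀ j, 0 < M.wordMatrix w i j → 0 < M.wordMatrix w i k := by
    intro F
    induction F using Finset.induction_on with
    | empty =>
      obtain ⟨i⟩ := ‹Nonempty S›
      exact ⟨0, Fin.elim0, i, ⟨i, by simp [wordMatrix_zero]⟩, by simp⟩
    | insert a F _ ih =>
      obtain ⟨t, w, k, ⟨i₀, hi₀⟩, hF⟩ := ih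
      by_cases ha : ∃ j, 0 < M.wordMatrix w a j
      · obtain ⟨j, hj⟩ := ha
        obtain ⟨s, v, l, hk, hjl⟩ := h.exists_wordMatrix_pos k j
        refine ⟨t + s, Fin.append w v, l, ⟨i₀, wordMatrix_append_pos hi₀ hk⟩, fun i hi m hm => ?_⟩
        rcases Finset.mem_insert.1 hi with rfl | hi
        · exact wordMatrix_append_pos hj hjl
        · obtain ⟨m', hm', -⟩ := exists_of_wordMatrix_append_pos hm
          exact wordMatrix_append_pos (hF i hi m' hm') hk
      · refine ⟨t, w, k, ⟨i₀, hi₀⟩, fun i hi m hm => ?_⟩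
        rcases Finset.mem_insert.1 hi with rfl | hi
        · exact absurd ⟨m, hm⟩ ha
        · exact hF i hi m hm
  obtain ⟨t, w, k, hk, hw⟩ := key Finset.univ
  exact ⟨t, w, k, hk, fun i => hw i (Finset.mem_univ i)⟩

omit [Nonempty S] in
theorem IsFlagWord.append {s t : ℕ} {w : Fin t → X} {v : Fin s → X} {k l : S}
    (h : M.IsFlagWord w k) (hv : 0 < M.wordMatrix v k l) : M.IsFlagWord (Fin.append w v) l := by
  obtain ⟨⟨i₀, hi₀⟩, hw⟩ := h
  refine ⟨⟨i₀, wordMatrix_append_pos hi₀ hv⟩, fun i j hj => ?_⟩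
  obtain ⟨m, hm, -⟩ := exists_of_wordMatrix_append_pos hj
  exact wordMatrix_append_pos (hw i m hm) hv

theorem IsFlagWord.exists_add (hM : M.IsIrreducible) {t : ℕ} {w : Fin t → X} {k : S}
    (h : M.IsFlagWord w k) (s : ℕ) : ∃ v : Fin (s + t) → X, M.IsFlagWord v k := by
  obtain ⟨⟨i₀, hi₀⟩, hw⟩ := h
  have hpos := M.stationary_spec.pos hM i₀
  rw [← M.stationary_spec.vecMul_pow s] at hpos
  obtain ⟨l, hl⟩ := exists_pos_of_sum_pos hpos
  obtain ⟨u, hu⟩ := M.exists_wordMatrix_pos (pos_and_pos_of_mul_pos (M.stationary_spec.1 l)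
    (Matrix.pow_apply_nonneg M.trans_nonneg s l i₀) hl).2
  refine ⟨Fin.append u w, ⟨l, wordMatrix_append_pos hu hi₀⟩, fun i j hj => ?_⟩
  obtain ⟨m, hm, hmj⟩ := exists_of_wordMatrix_append_pos hj
  exact wordMatrix_append_pos hm (hw m j hmj)

theorem IsFlagWord.exists_isFlagSymbol (hM : M.IsIrreducible) {n : ℕ} {w : Fin n → X} {k : S}
    (h : M.IsFlagWord w k) : ∃ x, (M.blockModel hM n).IsFlagSymbol x k := by
  obtain ⟨⟨i₀, hi₀⟩, hw⟩ := h
  have hP : 0 < M.outputLaw n w := by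
    rw [outputLaw_eq]
    refine Finset.sum_pos' (fun i _ => mul_nonneg (M.stationary_spec.1 i) (M.probFrom_nonneg w i))
      ⟨i₀, Finset.mem_univ _, mul_pos (M.stationary_spec.pos hM i₀) ?_⟩
    exact Finset.sum_pos' (fun j _ => M.wordMatrix_nonneg w i₀ j) ⟨k, Finset.mem_univ _, hi₀⟩
  refine ⟨⟨w, hP⟩, isFlagSymbol_iff _ |>.2 fun i hi => ?_⟩
  obtain ⟨j, hj⟩ := exists_pos_of_sum_pos hi
  have hT := fun j => blockModel_T hM (⟨w, hP⟩ : M.BlockAlphabet n) i j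
  exact (hw i j (hj.trans_eq (hT j))).trans_eq (hT k).symm

theorem IsPathMergeable.exists_isFlagState (hM : M.IsIrreducible) (h : M.IsPathMergeable) :
    ∃ n : ℕ, 1 ≤ n ∧ n.Coprime M.period ∧ (M.blockModel hM n).IsFlagState := by
  obtain ⟨t₀, w₀, k₀, h₀⟩ := h.exists_isFlagWord
  have hall : ∀ k, ∃ (t : ℕ) (w : Fin t → X), M.IsFlagWord w k := by
    intro k
    obtain ⟨m, -, hm⟩ := (Matrix.isIrreducible_iff_exists_pow_pos hM.nonneg).1 hM k₀ k
    obtain ⟨v, hv⟩ := M.exists_wordMatrix_pos hm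
    exact ⟨t₀ + m, _, h₀.append hv⟩
  choose t w hw using hall
  have hper : 0 < M.period := (Matrix.IsIrreducible.matrixPeriod_spec hM).1
  refine ⟨(∑ k, t k) * M.period + 1, by omega, by simp, fun k => ?_⟩
  have hle : t k ≤ (∑ k, t k) * M.period + 1 :=
    ((Finset.single_le_sum (fun k _ => Nat.zero_le (t k)) (Finset.mem_univ k)).trans
      (Nat.le_mul_of_pos_right _ hper)).trans (Nat.le_succ _)
  obtain ⟨s, hs⟩ := Nat.exists_eq_add_of_le' hle
  rw [hs]
  obtain ⟨v, hv⟩ := (hw k).exists_add hM s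
  exact hv.exists_isFlagSymbol hM

theorem IsPathMergeable.convergenceRate_lt_one (hM : M.IsIrreducible) (h : M.IsPathMergeable) :
    convergenceRate M.outputLaw < 1 := by
  obtain ⟨n, hn, hcop, hflag⟩ := h.exists_isFlagState hM
  choose y hy using hflag
  obtain ⟨hα0, hα1, hα⟩ := convergenceRate_le_flagRate hM hn hcop hy
  refine hα.trans_lt ?_
  rw [← EReal.coe_one, EReal.coe_lt_coe_iff]
  exact Real.rpow_lt_one hα0.le hα1 (by positivity)

end EdgeHMM

/-! ### State-emitting models -/

namespace StateHMM

variable {S X : Type*} [Fintype S] [Fintype X] [DecidableEq S] [Nonempty S]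

theorem outputLaw_toEdge (M : StateHMM S X) (hM : M.IsIrreducible) :
    (M.toEdge hM).outputLaw = M.outputLaw := by
  have htrans : (M.toEdge hM).trans = M.T := by
    ext i j
    simp only [EdgeHMM.trans, toEdge, ← Finset.mul_sum, M.O_sum, mul_one]
  have hstat : (M.toEdge hM).stationary = M.stationary :=
    IsStationaryDist.eq hM (htrans ▸ (M.toEdge hM).stationary_spec)
      (Classical.choose_spec (exists_isStationaryDist M.T_nonneg M.T_sum))
  ext t w
  rw [EdgeHMM.outputLaw, hstat]
  rfl

end StateHMM

end

theorem mainTheorem1 {S X : Type*} [Fintype S] [DecidableEq S] [Nonempty S] [Fintype X] :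
    (∀ (M : EdgeHMM S X) (hM : M.IsIrreducible),
      Tendsto (fun t : ℕ => blockEntropy M.outputLaw t / (t : ℝ)) atTop
        (𝓝 (entropyRate M.outputLaw)) ∧
      (∀ t : ℕ, 1 ≤ t → entropyRate M.outputLaw ≤ blockEstimate M.outputLaw t) ∧
      (∀ n : ℕ, 1 ≤ n → n.Coprime M.period → (M.blockModel hM n).IsFlagState →
        ∀ y : S → M.BlockAlphabet n, (∀ k, (M.blockModel hM n).IsFlagSymbol (y k) k) →
          0 < (M.blockModel hM n).flagRate y ∧ (M.blockModel hM n).flagRate y < 1 ∧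
          convergenceRate M.outputLaw ≤
            (((M.blockModel hM n).flagRate y ^ (1 / (n : ℝ)) : ℝ) : EReal)) ∧
      (M.IsPathMergeable →
        (∃ n : ℕ, 1 ≤ n ∧ n.Coprime M.period ∧ (M.blockModel hM n).IsFlagState) ∧
        convergenceRate M.outputLaw < 1)) ∧
    (∀ (M : StateHMM S X) (hM : M.IsIrreducible),
      Tendsto (fun t : ℕ => blockEntropy M.outputLaw t / (t : ℝ)) atTop
        (𝓝 (entropyRate M.outputLaw)) ∧
      (∀ t : ℕ, 1 ≤ t → entropyRate M.outputLaw ≤ blockEstimate M.outputLaw t) ∧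
      (∀ n : ℕ, 1 ≤ n → n.Coprime (M.toEdge hM).period →
        ((M.toEdge hM).blockModel ((M.toEdge_isIrreducible hM)) n).IsFlagState →
        ∀ y : S → (M.toEdge hM).BlockAlphabet n,
          (∀ k, ((M.toEdge hM).blockModel (M.toEdge_isIrreducible hM) n).IsFlagSymbol (y k) k) →
          0 < ((M.toEdge hM).blockModel (M.toEdge_isIrreducible hM) n).flagRate y ∧
          ((M.toEdge hM).blockModel (M.toEdge_isIrreducible hM) n).flagRate y < 1 ∧
          convergenceRate M.outputLaw ≤
            ((((M.toEdge hM).blockModel (M.toEdge_isIrreducible hM) n).flagRate y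
              ^ (1 / (n : ℝ)) : ℝ) : EReal)) ∧
      (M.IsPathMergeable → convergenceRate M.outputLaw < 1)) := by

  have hEdge : ∀ (M : EdgeHMM S X) (hM : M.IsIrreducible),
      Tendsto (fun t : ℕ => blockEntropy M.outputLaw t / (t : ℝ)) atTop
        (𝓝 (entropyRate M.outputLaw)) ∧
      (∀ t : ℕ, 1 ≤ t → entropyRate M.outputLaw ≤ blockEstimate M.outputLaw t) ∧
      (∀ n : ℕ, 1 ≤ n → n.Coprime M.period → (M.blockModel hM n).IsFlagState →
        ∀ y : S → M.BlockAlphabet n, (∀ k, (M.blockModel hM n).IsFlagSymbol (y k) k) →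
          0 < (M.blockModel hM n).flagRate y ∧ (M.blockModel hM n).flagRate y < 1 ∧
          convergenceRate M.outputLaw ≤
            (((M.blockModel hM n).flagRate y ^ (1 / (n : ℝ)) : ℝ) : EReal)) ∧
      (M.IsPathMergeable →
        (∃ n : ℕ, 1 ≤ n ∧ n.Coprime M.period ∧ (M.blockModel hM n).IsFlagState) ∧
        convergenceRate M.outputLaw < 1) := fun M hM =>
    ⟨M.isStationaryLaw.tendsto_blockEntropy_and_blockEstimate.1,
      fun _ ht => M.isStationaryLaw.entropyRate_le ht,
      fun _ hn hcop _ _ hy => EdgeHMM.convergenceRate_le_flagRate hM hn hcop hy,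
      fun h => ⟨h.exists_isFlagState hM, h.convergenceRate_lt_one hM⟩⟩
  refine ⟨hEdge, fun M hM => ?_⟩
  obtain ⟨h1, h2, h3, h4⟩ := hEdge (M.toEdge hM) (M.toEdge_isIrreducible hM)
  rw [M.outputLaw_toEdge hM] at h1 h2 h3 h4
  -- the transition probabilities on words of `M` and of its edge-emitting version coincide
  exact ⟨h1, h2, h3, fun h => (h4 h).2⟩
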